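/- Let $R$ be a commutative artinian ring and let $\Lambda$ be an artin $R$-algebra (an $R$-algebra that is finitely generated as an $R$-module) of finite global dimension. Let $\operatorname{mod}\Lambda$ be the category of finitely generated right $\Lambda$-modules, $K^b(\operatorname{mod}\Lambda)$ the homotopy category of bounded complexes over it, and $i\colon K^b_{\mathrm{ac}}(\operatorname{mod}\Lambda)\to K^b(\operatorname{mod}\Lambda)$ the inclusion of the full subcategory of acyclic complexes. Put $D=\operatorname{Hom}_R(-,E)$, where $E$ is an injective envelope of the $R$-module $R/\operatorname{rad}R$. A Serre functor on a Hom-finite Krull–Schmidt $R$-linear category $\mathcal T$ is an auto-equivalence $\mathbb S\colon\mathcal T\to\mathcal T$ for which there are $R$-linear isomorphisms $D\,\mathcal T(X,Y)\cong\mathcal T(Y,\mathbb S X)$ that are natural in $X,Y\in\mathcal T$. Then $K^b(\operatorname{mod}\Lambda)$ and $K^b_{\mathrm{ac}}(\operatorname{mod}\Lambda)$ are Hom-finite Krull–Schmidt categories, $K^b(\operatorname{mod}\Lambda)$ has a Serre functor, $i$ has a right adjoint, and for every Serre functor $\mathcal U$ on $K^b(\operatorname{mod}\Lambda)$ and every right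 adjoint $i_\rho$ of $i$ the composite $\mathbb S=i_\rho\circ\mathcal U\circ i$ is a Serre functor on $K^b_{\mathrm{ac}}(\operatorname{mod}\Lambda)$. In particular, $K^b_{\mathrm{ac}}(\operatorname{mod}\Lambda)$ has a Serre functor. -/

import Mathlib

open CategoryTheory CategoryTheory.Limits

universe w v u

/-! ### Finitely generated right modules over an artin algebra -/

/-- `mod Λ`: the category of finitely generated right `Λ`-modules, that is, of finitely generated
modules over the opposite ring. For an artin algebra these are the finitely presented ones. -/
abbrev FGRightMod (Λ : Type v) [Ring Λ] : Type (v + 1) := FGModuleCat.{v} Λᵐᵒᵖ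

/-- If `A` is an `R`-algebra, then `Mod A` is an `R`-linear category: `r • f` is the map
`x ↦ r · f x`, where `r` acts on `A`-modules through the structure map `R → A`. -/
noncomputable abbrev moduleCatLinear (R : Type u) (A : Type v) [CommRing R] [Ring A] [Algebra R A] :
    Linear R (ModuleCat.{v} A) :=
  letI (M : ModuleCat.{v} A) : Module R M := Module.restrictScalars R A M
  haveI (M : ModuleCat.{v} A) : IsScalarTower R A M := IsScalarTower.restrictScalars R A M
  { homModule := fun _ _ => inferInstance }

/-- The `R`-linear structure of `mod Λ`, for an `R`-algebra `Λ`. -/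
noncomputable instance fgRightModLinear (R : Type u) (Λ : Type v) [CommRing R] [Ring Λ]
    [Algebra R Λ] : Linear R (FGRightMod Λ) :=
  letI : Linear R (ModuleCat.{v} Λᵐᵒᵖ) := moduleCatLinear R Λᵐᵒᵖ
  Linear.fullSubcategory (R := R) (ModuleCat.isFG.{v} Λᵐᵒᵖ)

/-- The (left) global dimension of `A` is finite: the projective dimensions of all `A`-modules
are bounded by one natural number. -/
def HasFiniteGlobalDimension (A : Type v) [Ring A] : Prop :=
  ∃ n : ℕ, ∀ M : ModuleCat.{v} A, HasProjectiveDimensionLE M n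

/-- `ι : M → E` is an injective envelope of the `R`-module `M`: an essential embedding into an
injective module. -/
structure IsInjectiveEnvelope {R : Type u} [CommRing R] {M E : Type u} [AddCommGroup M]
    [Module R M] [AddCommGroup E] [Module R E] (ι : M →ₗ[R] E) : Prop where
  injective_module : Module.Injective R E
  injective : Function.Injective ι
  essential : ∀ N : Submodule R E, N ⊓ LinearMap.range ι = ⊥ → N = ⊥

/-! ### Bounded complexes up to homotopy -/

/-- A cochain complex up to homotopy which has only finitely many nonzero terms. -/
def isBoundedComplex (C : Type u) [Category.{v} C] [Preadditive C] :
    ObjectProperty (HomotopyCategory C (ComplexShape.up ℤ)) :=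
  fun X => ∃ a b : ℤ, ∀ i : ℤ, i < a ∨ b < i → IsZero (X.as.X i)

/-- `K^b(C)`: the homotopy category of bounded complexes over `C`. -/
abbrev Kb (C : Type u) [Category.{v} C] [Preadditive C] : Type (max u v) :=
  (isBoundedComplex C).FullSubcategory

/-- The acyclic complexes among the bounded complexes over `C` (used for `C` abelian). -/
def isAcyclicComplex (C : Type u) [Category.{v} C] [Preadditive C] : ObjectProperty (Kb C) :=
  fun X => ∀ i : ℤ, HomologicalComplex.ExactAt X.obj.as i

/-- `K^b_ac(C)`: the full subcategory of `K^b(C)` of all acyclic complexes. -/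
abbrev Kbac (C : Type u) [Category.{v} C] [Preadditive C] : Type (max u v) :=
  (isAcyclicComplex C).FullSubcategory

/-- The inclusion functor `K^b_ac(C) ⥤ K^b(C)`. -/
abbrev Kbac.inclusion (C : Type u) [Category.{v} C] [Preadditive C] : Kbac C ⥤ Kb C :=
  (isAcyclicComplex C).ι

/-! ### Serre functors -/

/-- The `R`-linear category `T` is Hom-finite: all Hom-modules are finitely generated over `R`
(that is, of finite length when `R` is artinian). -/
def IsHomFinite (R : Type w) [CommRing R] (T : Type u) [Category.{v} T] [Preadditive T]
    [Linear R T] : Prop :=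
  ∀ X Y : T, Module.Finite R (X ⟶ Y)

/-- `T` is a Krull-Schmidt category: an additive category in which every object is a finite direct
sum of objects with local endomorphism rings. -/
structure IsKrullSchmidt (T : Type u) [Category.{v} T] [Preadditive T] : Prop where
  hasFiniteBiproducts : HasFiniteBiproducts T
  exists_decomposition : ∀ X : T, ∃ (n : ℕ) (Y : Fin n → T) (b : Bicone Y),
    Nonempty b.IsBilimit ∧ Nonempty (b.pt ≅ X) ∧ ∀ i, IsLocalRing (End (Y i))

/-- `S : T ⥤ T` is a Serre functor with respect to the duality `D = Hom_R(-, E)`: it is an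
auto-equivalence and there are `R`-linear isomorphisms `D T(X, Y) ≅ T(Y, S X)`, natural in both
variables. -/
structure IsSerreFunctor (R : Type w) [CommRing R] (E : Type w) [AddCommGroup E] [Module R E]
    {T : Type u} [Category.{v} T] [Preadditive T] [Linear R T] (S : T ⥤ T) : Prop where
  isEquivalence : S.IsEquivalence
  exists_iso : ∃ η : ∀ X Y : T, ((X ⟶ Y) →ₗ[R] E) ≃ₗ[R] (Y ⟶ S.obj X),
    (∀ (X X' Y : T) (f : X ⟶ X') (φ : (X ⟶ Y) →ₗ[R] E),
      η X' Y (φ ∘ₗ Linear.leftComp R Y f) = η X Y φ ≫ S.map f) ∧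
    (∀ (X Y Y' : T) (g : Y ⟶ Y') (φ : (X ⟶ Y') →ₗ[R] E),
      η X Y (φ ∘ₗ Linear.rightComp R X g) = g ≫ η X Y' φ)

/-! `D = Hom_R(-, E)` is exact and a duality on finitely generated `R`-modules. A Serre functor is
assembled from Serre pairs: functionals `θ` on `T(X, S)` through which `S` represents `D T(X, -)`.
If every object occurs as such an `X`, Yoneda turns `X ↦ S` into a functor and biduality makes it
fully faithful; if every object also occurs as an `S`, it is an equivalence
(`exists_isSerreFunctor`).

In a Hom-finite triangulated category both classes of objects are triangulated subcategories: a
functional on a cone exists because `E` is injective, and the five lemma shows that it gives a Serre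
pair (`exists_isSerrePair_of_distTriang`). In `K^b(mod Λ)` it is therefore enough to treat stalk
complexes. In `mod Λ` itself, `Λ` and `D Λ` form a Serre pair. If `P₁ → P₀ → M → 0` is a
presentation by sums of `Λ` and `I₁ → I₀` is its dual, with kernel `K`, then `0 → Hom(-, K) → Hom(-,
I₁) → Hom(-, I₀) → D Hom(M, -) → 0` is exact, so `K → I₁ → I₀` is the Serre dual of `M` placed in
degree 2 (`Kb.exists_isSerrePair_single`). Starting instead from a copresentation `N → I₁ → I₀`,
dévissage shows that every `N` is a Serre dual.

Finite global dimension enters only through the adjoints of `i`. Stalk complexes of injectives are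
right orthogonal to acyclic complexes, and finite injective resolutions show that the two together
exhaust `K^b`; this gives the right adjoint. Projectives dually give reflections. Then `Hom(Y, i_ρ U
i X) ≅ Hom(iY, U i X) ≅ D Hom(iX, iY)`, and the reflections give essential surjectivity
(`isSerreFunctor_of_coreflective`).

The Krull-Schmidt property follows from Hom-finiteness and split idempotents; idempotents of `K^b`
lift to complexes because endomorphism rings of bounded complexes are finite `R`-algebras. -/

set_option linter.unusedSectionVars false

/-! ### Matlis duality over an artinian ring -/

section Matlis

variable (R : Type w) [CommRing R] (E : Type u) [AddCommGroup E] [Module R E]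

/-- The evaluation map `M → D D M` of the duality `D = Hom_R(-, E)`. -/
def dualEval (M : Type v) [AddCommGroup M] [Module R M] : M →ₗ[R] ((M →ₗ[R] E) →ₗ[R] E) :=
  LinearMap.flip LinearMap.id

@[simp] lemma dualEval_apply (M : Type v) [AddCommGroup M] [Module R M] (x : M) (φ : M →ₗ[R] E) :
    dualEval R E M x φ = φ x := rfl

/-- `E` is injective and every finitely generated module is reflexive for `Hom_R(-, E)`. -/
structure IsMatlisDualizing : Prop where
  baer : Module.Baer R E
  bijective_dualEval : ∀ (M : Type v) [AddCommGroup M] [Module R M], Module.Finite R M →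
    Function.Bijective (dualEval R E M)

variable {R E}

/-- A functional that kills `ker g` descends to `N / ker g`, which embeds in `P`, and extends from
there. Baer's condition, unlike injectivity, puts no constraint on the universes of the modules. -/
lemma Module.Baer.exact_lcomp (hE : Module.Baer R E) {M N P : Type*} [AddCommGroup M] [Module R M]
    [AddCommGroup N] [Module R N] [AddCommGroup P] [Module R P] {f : M →ₗ[R] N} {g : N →ₗ[R] P}
    (h : Function.Exact f g) : Function.Exact (LinearMap.lcomp R E g) (LinearMap.lcomp R E f) := by
  intro φ
  constructor
  · intro hφ
    have hk : LinearMap.ker g ≤ LinearMap.ker φ := by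
      intro x hx
      obtain ⟨y, rfl⟩ := (h x).1 hx
      exact DFunLike.congr_fun hφ y
    obtain ⟨ψ, hψ⟩ := hE.extension_property ((LinearMap.ker g).liftQ g le_rfl)
      (by rw [← LinearMap.ker_eq_bot]; exact Submodule.ker_liftQ_eq_bot _ _ _ le_rfl)
      ((LinearMap.ker g).liftQ φ hk)
    refine ⟨ψ, ?_⟩
    ext x
    exact DFunLike.congr_fun hψ (Submodule.Quotient.mk x)
  · rintro ⟨ψ, rfl⟩
    ext x
    change ψ (g (f x)) = 0
    rw [h.apply_apply_eq_zero, map_zero]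

/-- The form in which injectivity of `E` is used to construct functionals below. -/
lemma Module.Baer.exists_comp_eq (hE : Module.Baer R E) {N P : Type*} [AddCommGroup N] [Module R N]
    [AddCommGroup P] [Module R P] (g : N →ₗ[R] P) (φ : N →ₗ[R] E)
    (h : ∀ x, g x = 0 → φ x = 0) : ∃ ψ : P →ₗ[R] E, ψ ∘ₗ g = φ := by
  have := (hE.exact_lcomp (f := (LinearMap.ker g).subtype) (g := g)
    (by rw [LinearMap.exact_iff]; simp) φ).1 (by ext x; exact h x x.2)
  exact this

variable {R : Type u} [CommRing R] {E : Type u} [AddCommGroup E] [Module R E]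
  {ι : (R ⧸ Ring.jacobson R) →ₗ[R] E}

lemma IsInjectiveEnvelope.baer (hE : IsInjectiveEnvelope ι) : Module.Baer R E :=
  have := hE.injective_module
  Module.Baer.of_injective inferInstance

/-- Any two elements of `E` killed by the same maximal ideal are proportional. -/
lemma IsInjectiveEnvelope.exists_smul_eq (hE : IsInjectiveEnvelope ι) (m : Ideal R) [hm : m.IsMaximal]
    {x y : E} (hx : ∀ a ∈ m, a • x = 0) (hy : ∀ a ∈ m, a • y = 0) (hx0 : x ≠ 0) :
    ∃ r : R, r • x = y := by
  have inv : ∀ r ∉ m, ∃ s, 1 - s * r ∈ m := by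
    intro r hr
    obtain ⟨s, hs⟩ := hm.exists_inv hr
    obtain ⟨a, ha, h⟩ := hs
    exact ⟨s, by rw [← h]; simpa using ha⟩
  have mem : ∀ x : E, (∀ a ∈ m, a • x = 0) → ∃ z, ι z = x := by
    intro x hx
    by_cases hx0 : x = 0
    · exact ⟨0, by simp [hx0]⟩
    have h := mt (hE.essential (R ∙ x)) (by simpa using hx0)
    obtain ⟨w, ⟨hw₁, z, rfl⟩, hw0⟩ := (Submodule.ne_bot_iff _).1 h
    obtain ⟨r, hr⟩ := Submodule.mem_span_singleton.1 hw₁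
    obtain ⟨s, hs⟩ := inv r (fun h => hw0 (by rw [← hr, hx r h]))
    refine ⟨s • z, ?_⟩
    have := hx _ hs
    rw [sub_smul, one_smul, sub_eq_zero, mul_smul, hr] at this
    rw [map_smul, ← this]
  obtain ⟨z, rfl⟩ := mem x hx
  obtain ⟨w, rfl⟩ := mem y hy
  obtain ⟨a, rfl⟩ := Submodule.Quotient.mk_surjective _ z
  obtain ⟨b, rfl⟩ := Submodule.Quotient.mk_surjective _ w
  have key : ∀ c : R, (∀ a ∈ m, a • ι (Submodule.Quotient.mk c) = 0) →
      ∀ a ∈ m, a * c ∈ Ring.jacobson R := by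
    intro c hc a ha
    have := hc a ha
    rw [← map_smul, ← map_zero ι] at this
    exact (Submodule.Quotient.mk_eq_zero _).1 (hE.injective this)
  have ha : a ∉ m := by
    intro ha
    have h1 := key a hx a ha
    apply hx0
    have : a ∈ Ring.jacobson R := by
      rw [Ring.jacobson_eq_sInf_isMaximal, Submodule.mem_sInf] at h1 ⊢
      intro I hI
      have hI' : Ideal.IsMaximal I := hI
      exact (hI'.isPrime.mem_or_mem (h1 I hI)).elim id id
    rw [(Submodule.Quotient.mk_eq_zero _).2 this, map_zero]
  obtain ⟨s, hs⟩ := inv a ha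
  refine ⟨b * s, ?_⟩
  rw [← map_smul, ← Submodule.Quotient.mk_smul]
  congr 1
  rw [eq_comm, Submodule.Quotient.eq, smul_eq_mul]
  have := key b hy _ hs
  convert this using 1
  ring

/-- Since `R / rad R` is semisimple, the image of `m` has a complement `N`. It is nonzero because
`m` is proper, and `m` kills it because `m N` lies in both summands. -/
lemma IsInjectiveEnvelope.exists_ne_zero [IsArtinianRing R] (hE : IsInjectiveEnvelope ι)
    (m : Ideal R) [hm : m.IsMaximal] : ∃ x : E, x ≠ 0 ∧ ∀ a ∈ m, a • x = 0 := by
  have hss : IsSemisimpleModule R (R ⧸ Ring.jacobson R) := by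
    rw [IsArtinian.isSemisimpleModule_iff_jacobson]
    exact Module.jacobson_quotient_jacobson R R
  obtain ⟨N, hN⟩ := exists_isCompl (Submodule.map (Submodule.mkQ (Ring.jacobson R)) m)
  have hJ : Ring.jacobson R ≤ m := by
    rw [Ring.jacobson_eq_sInf_isMaximal]
    exact sInf_le hm
  have hN0 : N ≠ ⊥ := by
    rintro rfl
    have h := hN.sup_eq_top
    rw [sup_bot_eq] at h
    have h1 : Submodule.Quotient.mk (p := Ring.jacobson R) 1 ∈
      Submodule.map (Submodule.mkQ (Ring.jacobson R)) m := by rw [h]; trivial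
    obtain ⟨a, ha, h1⟩ := h1
    have : a - 1 ∈ m := hJ ((Submodule.Quotient.eq _).1 h1)
    exact hm.ne_top ((Ideal.eq_top_iff_one _).2 (by simpa using m.sub_mem ha this))
  obtain ⟨z, hz, hz0⟩ := (Submodule.ne_bot_iff _).1 hN0
  refine ⟨ι z, fun h => hz0 (hE.injective (by rw [h, map_zero])), fun a ha => ?_⟩
  have : a • z ∈ Submodule.map (Submodule.mkQ (Ring.jacobson R)) m ⊓ N := by
    refine ⟨?_, N.smul_mem a hz⟩
    obtain ⟨b, rfl⟩ := Submodule.Quotient.mk_surjective _ z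
    exact ⟨a * b, m.mul_mem_right b ha, rfl⟩
  rw [hN.inf_eq_bot, Submodule.mem_bot] at this
  rw [← map_smul, this, map_zero]

/-- Evaluation at `1` identifies `D (R / m)` with the elements of `E` killed by `m`; these form a
nonzero module generated by any of its nonzero elements. -/
lemma IsInjectiveEnvelope.isSimpleModule_dual [IsArtinianRing R] (hE : IsInjectiveEnvelope ι)
    (S : Type v) [AddCommGroup S] [Module R S] [IsSimpleModule R S] :
    IsSimpleModule R (S →ₗ[R] E) := by
  obtain ⟨m, hm, ⟨e⟩⟩ := isSimpleModule_iff_quot_maximal.1 (inferInstance : IsSimpleModule R S)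
  have hann : ∀ (φ : (R ⧸ m) →ₗ[R] E), ∀ a ∈ m, a • φ (Submodule.Quotient.mk 1) = 0 := by
    intro φ a ha
    rw [← map_smul, ← Submodule.Quotient.mk_smul, (Submodule.Quotient.mk_eq_zero _).2, map_zero]
    simpa using ha
  suffices h : IsSimpleModule R ((R ⧸ m) →ₗ[R] E) from
    IsSimpleModule.congr (e.congrLeft E R)
  rw [isSimpleModule_iff_toSpanSingleton_surjective]
  constructor
  · obtain ⟨x, hx0, hx⟩ := hE.exists_ne_zero m
    refine ⟨⟨m.liftQ (LinearMap.toSpanSingleton R E x) hx, 0, fun h => hx0 ?_⟩⟩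
    simpa using (show (1 : R) • x = 0 from DFunLike.congr_fun h (Submodule.Quotient.mk 1))
  · intro φ hφ ψ
    obtain ⟨r, hr⟩ := hE.exists_smul_eq m (hann φ) (hann ψ) (fun h => hφ (by
      ext
      simpa using h))
    refine ⟨r, ?_⟩
    ext
    simpa using hr

/-- Induction along a composition series: a simple module has a simple bidual, and exactness of `D`
and `D D` carries both properties through extensions. -/
lemma IsInjectiveEnvelope.bijective_and_finite [IsArtinianRing R] (hE : IsInjectiveEnvelope ι)
    (M : Type v) [AddCommGroup M] [Module R M] (hM : IsFiniteLength R M) :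
    Function.Bijective (dualEval R E M) ∧ Module.Finite R (M →ₗ[R] E) := by
  induction hM with
  | @of_subsingleton M _ _ _ =>
    have : Subsingleton (M →ₗ[R] E) := ⟨fun f g => by ext x; simp [Subsingleton.elim x 0]⟩
    have : Subsingleton ((M →ₗ[R] E) →ₗ[R] E) :=
      ⟨fun f g => by ext x; simp [Subsingleton.elim x 0]⟩
    exact ⟨⟨fun _ _ _ => Subsingleton.elim _ _, fun _ => ⟨0, Subsingleton.elim _ _⟩⟩,
      inferInstance⟩
  | @of_simple_quotient M _ _ N hS _ ih =>
    obtain ⟨ih, ihf⟩ := ih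
    have h₁ := hE.isSimpleModule_dual (M ⧸ N)
    have h₂ := hE.isSimpleModule_dual ((M ⧸ N) →ₗ[R] E)
    have hex : Function.Exact N.subtype N.mkQ := LinearMap.exact_subtype_mkQ N
    have hD := hE.baer.exact_lcomp hex
    have hDD := hE.baer.exact_lcomp hD
    constructor
    -- By Schur's lemma it suffices that evaluation is nonzero, and it is detected by any nonzero
    -- functional.
    · have hS : Function.Bijective (dualEval R E (M ⧸ N)) := by
        refine LinearMap.bijective_of_ne_zero fun h => ?_
        have := h₁.nontrivial
        obtain ⟨φ, hφ⟩ := exists_ne (0 : (M ⧸ N) →ₗ[R] E)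
        apply hφ
        ext x
        exact DFunLike.congr_fun (DFunLike.congr_fun h (N.mkQ x)) φ
      have hinj : Function.Injective (LinearMap.lcomp R E (LinearMap.lcomp R E N.subtype)) := by
        rw [← LinearMap.ker_eq_bot]
        rw [LinearMap.ker_eq_bot']
        intro χ hχ
        ext φ
        obtain ⟨ψ, rfl⟩ := hE.baer.extension_property N.subtype N.injective_subtype φ
        exact DFunLike.congr_fun hχ ψ
      constructor
      · rw [← LinearMap.ker_eq_bot, LinearMap.ker_eq_bot']
        intro x hx
        have hx' : x ∈ N := by
          rw [← Submodule.Quotient.mk_eq_zero]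
          apply hS.1
          ext φ
          rw [map_zero]
          exact DFunLike.congr_fun hx (φ ∘ₗ N.mkQ)
        suffices (⟨x, hx'⟩ : N) = 0 by simpa using this
        apply ih.1
        apply hinj
        ext φ
        rw [map_zero, map_zero]
        exact DFunLike.congr_fun hx φ
      · intro χ
        -- Subtract from `χ` the evaluation at a lift of its image in the bidual of `M ⧸ N`; the
        -- difference comes from the bidual of `N`.
        obtain ⟨y, hy⟩ := hS.2 (LinearMap.lcomp R E (LinearMap.lcomp R E N.mkQ) χ)
        obtain ⟨x, rfl⟩ := N.mkQ_surjective y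
        obtain ⟨χ', hχ'⟩ := (hDD (χ - dualEval R E M x)).1 (by
          rw [map_sub, sub_eq_zero, ← hy]
          ext φ
          rfl)
        obtain ⟨n, rfl⟩ := ih.2 χ'
        refine ⟨n + x, ?_⟩
        rw [map_add, ← eq_sub_iff_add_eq, ← hχ']
        ext φ
        rfl
    · have : IsNoetherian R (N →ₗ[R] E) := isNoetherian_of_isNoetherianRing_of_finite R _
      have : IsNoetherian R (M →ₗ[R] E) :=
        isNoetherian_of_range_eq_ker _ _ (LinearMap.exact_iff.1 hD).symm
      infer_instance

theorem IsInjectiveEnvelope.isMatlisDualizing [IsArtinianRing R] (hE : IsInjectiveEnvelope ι) :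
    IsMatlisDualizing.{u, v, u} R E where
  baer := hE.baer
  bijective_dualEval M _ _ hM := by
    exact (hE.bijective_and_finite M (isFiniteLength_iff_isNoetherian_isArtinian.2
      ⟨inferInstance, inferInstance⟩)).1

theorem IsInjectiveEnvelope.finite_dual [IsArtinianRing R] (hE : IsInjectiveEnvelope ι)
    (M : Type v) [AddCommGroup M] [Module R M] [Module.Finite R M] : Module.Finite R (M →ₗ[R] E) :=
  (hE.bijective_and_finite M (isFiniteLength_iff_isNoetherian_isArtinian.2
      ⟨inferInstance, inferInstance⟩)).2

end Matlis

/-! ### Serre pairs -/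

section SerrePair

variable {R : Type w} [CommRing R] {E : Type w} [AddCommGroup E] [Module R E]
  {T : Type u} [Category.{v} T] [Preadditive T] [Linear R T]

/-- The map `T(Y, S) → D T(X, Y)` induced by a functional on `T(X, S)`. -/
def serreMap {X S : T} (θ : (X ⟶ S) →ₗ[R] E) (Y : T) : (Y ⟶ S) →ₗ[R] ((X ⟶ Y) →ₗ[R] E) where
  toFun g := θ ∘ₗ Linear.rightComp R X g
  map_add' _ _ := by ext; simp
  map_smul' _ _ := by ext; simp

/-- The map `T(X, Y) → D T(Y, S)` induced by a functional on `T(X, S)`. -/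
def serreMapLeft {X S : T} (θ : (X ⟶ S) →ₗ[R] E) (Y : T) :
    (X ⟶ Y) →ₗ[R] ((Y ⟶ S) →ₗ[R] E) where
  toFun f := θ ∘ₗ Linear.leftComp R S f
  map_add' _ _ := by ext; simp
  map_smul' _ _ := by ext; simp

@[simp] lemma serreMap_apply {X S Y : T} (θ : (X ⟶ S) →ₗ[R] E) (g : Y ⟶ S) (f : X ⟶ Y) :
    serreMap θ Y g f = θ (f ≫ g) := rfl

@[simp] lemma serreMapLeft_apply {X S Y : T} (θ : (X ⟶ S) →ₗ[R] E) (f : X ⟶ Y) (g : Y ⟶ S) :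
    serreMapLeft θ Y f g = θ (f ≫ g) := rfl

/-- `S` represents `D T(X, -)` through the functional `θ` on `T(X, S)`. -/
def IsSerrePair {X S : T} (θ : (X ⟶ S) →ₗ[R] E) : Prop :=
  ∀ Y : T, Function.Bijective (serreMap θ Y)

variable (R E T) in
/-- The objects `X` such that `D T(X, -)` is representable. -/
def hasSerreDual : ObjectProperty T := fun X => ∃ (S : T) (θ : (X ⟶ S) →ₗ[R] E), IsSerrePair θ

variable (R E T) in
/-- The objects which represent a functor `D T(X, -)`. -/
def isSerreDual : ObjectProperty T := fun S => ∃ (X : T) (θ : (X ⟶ S) →ₗ[R] E), IsSerrePair θ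

section

variable {X S : T} {θ : (X ⟶ S) →ₗ[R] E}

/-- Dualize `T(Y, S) ≅ D T(X, Y)` and use that `T(X, Y)` is reflexive. -/
lemma IsSerrePair.bijective_left (hθ : IsSerrePair θ) (hE : IsMatlisDualizing.{w, v, w} R E)
    (hT : IsHomFinite R T) (Y : T) : Function.Bijective (serreMapLeft θ Y) := by
  have h := hE.bijective_dualEval (X ⟶ Y) (hT X Y)
  let e := LinearEquiv.ofBijective _ (hθ Y)
  have : ⇑(serreMapLeft θ Y) = ⇑(e.congrLeft E R).symm ∘ dualEval R E (X ⟶ Y) := by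
    ext f g
    rfl
  rw [this]
  exact (LinearEquiv.bijective _).comp h

lemma IsSerrePair.surjective (hθ : IsSerrePair θ) {Y : T} (φ : (X ⟶ Y) →ₗ[R] E) :
    ∃ g : Y ⟶ S, ∀ f, θ (f ≫ g) = φ f := by
  obtain ⟨g, hg⟩ := (hθ Y).2 φ
  exact ⟨g, fun f => DFunLike.congr_fun hg f⟩

lemma IsSerrePair.ext (hθ : IsSerrePair θ) {Y : T} {g g' : Y ⟶ S}
    (h : ∀ f : X ⟶ Y, θ (f ≫ g) = θ (f ≫ g')) : g = g' :=
  (hθ Y).1 (LinearMap.ext h)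

lemma bijective_serreMap_of_iso {Y Y' : T} (e : Y ≅ Y') (h : Function.Bijective (serreMap θ Y)) :
    Function.Bijective (serreMap θ Y') := by
  constructor
  · intro g g' hg
    rw [← cancel_epi e.hom]
    apply h.1
    ext f
    simpa using DFunLike.congr_fun hg (f ≫ e.hom)
  · intro φ
    obtain ⟨g, hg⟩ := h.2 (φ ∘ₗ Linear.rightComp R X e.hom)
    refine ⟨e.inv ≫ g, ?_⟩
    ext f
    simpa using DFunLike.congr_fun hg (f ≫ e.inv)

lemma IsSerrePair.of_iso_left (hθ : IsSerrePair θ) {X' : T} (e : X ≅ X') :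
    IsSerrePair (θ ∘ₗ Linear.leftComp R S e.hom) := by
  intro Y
  constructor
  · intro g g' hg
    apply hθ.ext
    intro f
    simpa using DFunLike.congr_fun hg (e.inv ≫ f)
  · intro φ
    obtain ⟨g, hg⟩ := hθ.surjective (φ ∘ₗ Linear.leftComp R Y e.inv)
    refine ⟨g, ?_⟩
    ext f
    simpa using hg (e.hom ≫ f)

lemma IsSerrePair.of_iso_right (hθ : IsSerrePair θ) {S' : T} (e : S ≅ S') :
    IsSerrePair (θ ∘ₗ Linear.rightComp R X e.inv) := by
  intro Y
  constructor
  · intro g g' hg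
    rw [← cancel_mono e.inv]
    apply hθ.ext
    intro f
    simpa using DFunLike.congr_fun hg f
  · intro φ
    obtain ⟨g, hg⟩ := hθ.surjective φ
    refine ⟨g ≫ e.hom, ?_⟩
    ext f
    simpa using hg f

/-- Two objects representing the same functor `D T(X, -)` are isomorphic. -/
lemma IsSerrePair.nonempty_iso (hθ : IsSerrePair θ) {S' : T} {θ' : (X ⟶ S') →ₗ[R] E}
    (hθ' : IsSerrePair θ') : Nonempty (S ≅ S') := by
  obtain ⟨a, ha⟩ := hθ'.surjective θ
  obtain ⟨b, hb⟩ := hθ.surjective θ'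
  exact ⟨⟨a, b, hθ.ext fun f => by rw [← Category.assoc, hb, ha, Category.comp_id],
    hθ'.ext fun f => by rw [← Category.assoc, ha, hb, Category.comp_id]⟩⟩

end

instance : (hasSerreDual R E T).IsClosedUnderIsomorphisms where
  of_iso := by
    rintro X X' e ⟨S, θ, hθ⟩
    exact ⟨S, _, hθ.of_iso_left e⟩

instance : (isSerreDual R E T).IsClosedUnderIsomorphisms where
  of_iso := by
    rintro S S' e ⟨X, θ, hθ⟩
    exact ⟨X, _, hθ.of_iso_right e⟩

lemma isSerrePair_of_isZero {X S : T} (hX : IsZero X) (hS : IsZero S) :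
    IsSerrePair (0 : (X ⟶ S) →ₗ[R] E) := by
  intro Y
  refine ⟨fun g g' _ => hS.eq_of_tgt _ _, fun φ => ⟨0, ?_⟩⟩
  ext f
  rw [hX.eq_of_src f 0, map_zero, map_zero]

/-- The functional is a trace: the sum of `θ` over the diagonal entries of a matrix of morphisms. -/
lemma IsSerrePair.biproduct [HasFiniteBiproducts T] {X S : T} {θ : (X ⟶ S) →ₗ[R] E}
    (hθ : IsSerrePair θ) (n : ℕ) :
    ∃ θ' : ((⨁ fun _ : Fin n => X) ⟶ (⨁ fun _ : Fin n => S)) →ₗ[R] E, IsSerrePair θ' := by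
  classical
  refine ⟨∑ i, θ ∘ₗ Linear.leftComp R S (biproduct.ι (fun _ : Fin n => X) i) ∘ₗ
    Linear.rightComp R _ (biproduct.π (fun _ : Fin n => S) i), fun Y => ⟨fun g g' hg => ?_,
    fun φ => ?_⟩⟩
  · refine biproduct.hom_ext _ _ fun i => hθ.ext fun f => ?_
    have := DFunLike.congr_fun hg (biproduct.π (fun _ : Fin n => X) i ≫ f)
    have h0 : ∀ (j : Fin n) (k : X ⟶ S), θ ((if j = i then 𝟙 X else 0) ≫ k) =
        if j = i then θ k else 0 := by
      intro j k
      split_ifs <;> simp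
    simpa [biproduct.ι_π_assoc, h0] using this
  · have h := fun i => hθ.surjective (φ ∘ₗ Linear.leftComp R Y
      (biproduct.π (fun _ : Fin n => X) i))
    choose g hg using h
    refine ⟨biproduct.lift g, ?_⟩
    ext f
    have hf : f = ∑ i, biproduct.π (fun _ : Fin n => X) i ≫ biproduct.ι (fun _ => X) i ≫ f := by
      simp_rw [← Category.assoc, ← Preadditive.sum_comp, biproduct.total, Category.id_comp]
    conv_rhs => rw [hf, map_sum]
    simp only [serreMap_apply, LinearMap.sum_apply, LinearMap.comp_apply,
      Linear.leftComp_apply, Linear.rightComp_apply, Category.assoc, biproduct.lift_π] at hg ⊢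
    refine Finset.sum_congr rfl fun i _ => ?_
    rw [← hg, Category.assoc]

/-- A functor whose values form Serre pairs, compatibly with morphisms, is a Serre functor as soon
as every object is part of a Serre pair on the right. -/
theorem isSerreFunctor_of_isSerrePair (hE : IsMatlisDualizing.{w, v, w} R E) (hT : IsHomFinite R T)
    (S : T ⥤ T) (θ : ∀ X, (X ⟶ S.obj X) →ₗ[R] E) (hθ : ∀ X, IsSerrePair (θ X))
    (nat : ∀ {X X' : T} (f : X ⟶ X') (g : X' ⟶ S.obj X), θ X' (g ≫ S.map f) = θ X (f ≫ g))
    (hl : ∀ Y, isSerreDual R E T Y) : IsSerreFunctor R E S where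
  isEquivalence := by
    have hff : ∀ X X', Function.Bijective (S.map : (X ⟶ X') → (S.obj X ⟶ S.obj X')) := by
      intro X X'
      -- Naturality of `θ` factors the bijection `serreMapLeft` as `S.map` followed by the bijection
      -- `serreMap`, so `S.map` is bijective.
      have : serreMap (θ X') (S.obj X) ∘ (S.map : (X ⟶ X') → (S.obj X ⟶ S.obj X')) =
          serreMapLeft (θ X) X' := by
        ext f g
        exact nat f g
      have hb := (hθ X).bijective_left hE hT X'
      rw [← this] at hb
      exact (Function.Bijective.of_comp_iff' (hθ X' _) _).1 hb
    exact
      { faithful := ⟨fun h => (hff _ _).1 h⟩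
        full := ⟨fun g => (hff _ _).2 g⟩
        essSurj := ⟨fun Y => by
          obtain ⟨X, θ', hθ'⟩ := hl Y
          obtain ⟨e⟩ := (hθ X).nonempty_iso hθ'
          exact ⟨X, ⟨e⟩⟩⟩ }
  exists_iso := by
    refine ⟨fun X Y => (LinearEquiv.ofBijective _ (hθ X Y)).symm, ?_, ?_⟩
    · intro X X' Y f φ
      rw [LinearEquiv.symm_apply_eq]
      obtain ⟨k, rfl⟩ := (hθ X Y).2 φ
      ext h
      have : (LinearEquiv.ofBijective _ (hθ X Y)).symm (serreMap (θ X) Y k) = k :=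
        LinearEquiv.symm_apply_apply (LinearEquiv.ofBijective _ (hθ X Y)) k
      rw [this]
      refine Eq.trans ?_ ((nat f (h ≫ k)).symm.trans ?_)
      · exact congrArg (θ X) (Category.assoc f h k)
      · rw [Category.assoc]
        rfl
    · intro X Y Y' g φ
      rw [LinearEquiv.symm_apply_eq]
      obtain ⟨k, rfl⟩ := (hθ X Y').2 φ
      ext h
      have : (LinearEquiv.ofBijective _ (hθ X Y')).symm (serreMap (θ X) Y' k) = k :=
        LinearEquiv.symm_apply_apply (LinearEquiv.ofBijective _ (hθ X Y')) k
      rw [this]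
      simp

/-- If all functors `D T(X, -)` are representable and all objects represent such a functor, then
there is a Serre functor. -/
theorem exists_isSerreFunctor (hE : IsMatlisDualizing.{w, v, w} R E) (hT : IsHomFinite R T)
    (hr : ∀ X, hasSerreDual R E T X) (hl : ∀ Y, isSerreDual R E T Y) :
    ∃ S : T ⥤ T, IsSerreFunctor R E S := by
  choose S θ hθ using hr
  -- The value of the functor at `f` is forced: it is the morphism representing the functional `g ↦
  -- θ X (f ≫ g)`. Uniqueness gives functoriality.
  have h := fun (X X' : T) (f : X ⟶ X') =>
    (hθ X').surjective (θ X ∘ₗ Linear.leftComp R (S X) f)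
  choose m hm using h
  simp only [LinearMap.comp_apply, Linear.leftComp_apply] at hm
  refine ⟨{ obj := S, map := fun {X X'} f => m X X' f, map_id := ?_, map_comp := ?_ },
    isSerreFunctor_of_isSerrePair hE hT _ θ hθ (fun f g => hm _ _ f g) hl⟩
  · intro X
    exact (hθ X).ext fun f => by simp [hm]
  · intro X Y Z f g
    exact (hθ Z).ext fun k => by
      rw [hm, ← Category.assoc k, hm, ← Category.assoc g, hm, Category.assoc]

/-- Yoneda: `θ X` is the functional that corresponds to the identity of `S.obj X`. -/
lemma IsSerreFunctor.exists_isSerrePair {S : T ⥤ T} (hS : IsSerreFunctor R E S) :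
    ∃ θ : ∀ X, (X ⟶ S.obj X) →ₗ[R] E, (∀ X, IsSerrePair (θ X)) ∧
      ∀ {X X' : T} (f : X ⟶ X') (g : X' ⟶ S.obj X), θ X' (g ≫ S.map f) = θ X (f ≫ g) := by
  obtain ⟨η, hη₁, hη₂⟩ := hS.exists_iso
  have key : ∀ X Y, serreMap ((η X (S.obj X)).symm (𝟙 _)) Y = (η X Y).symm := by
    intro X Y
    ext g : 1
    have := hη₂ X Y _ g ((η X (S.obj X)).symm (𝟙 _))
    rw [LinearEquiv.apply_symm_apply, Category.comp_id] at this
    exact ((η X Y).symm_apply_eq.2 this.symm).symm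
  refine ⟨fun X => (η X (S.obj X)).symm (𝟙 _), fun X Y => ?_, fun {X X'} f g => ?_⟩
  · rw [key]
    exact (η X Y).symm.bijective
  · have := hη₁ X X' _ f ((η X _).symm g)
    rw [LinearEquiv.apply_symm_apply, ← LinearEquiv.eq_symm_apply] at this
    have h₁ : (η X X').symm g = serreMap ((η X (S.obj X)).symm (𝟙 _)) X' g := by rw [key]; rfl
    have h₂ : (η X' X').symm (g ≫ S.map f) =
      serreMap ((η X' (S.obj X')).symm (𝟙 _)) X' (g ≫ S.map f) := by rw [key]; rfl
    rw [h₁, h₂] at this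
    simpa using (DFunLike.congr_fun this (𝟙 X')).symm

end SerrePair

/-! ### Serre pairs in triangulated categories -/

section TriangulatedSerrePair

open Pretriangulated ZeroObject

variable {R : Type w} [CommRing R] {E : Type w} [AddCommGroup E] [Module R E]
  {T : Type u} [Category.{v} T] [Preadditive T] [Linear R T]

lemma IsSerrePair.neg {X S : T} {θ : (X ⟶ S) →ₗ[R] E} (hθ : IsSerrePair θ) : IsSerrePair (-θ) := by
  intro Y
  have : ⇑(serreMap (-θ) Y) = (fun φ => -φ) ∘ serreMap θ Y := by
    ext g f
    simp
  rw [this]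
  exact (Equiv.neg _).bijective.comp (hθ Y)

section

variable [HasShift T ℤ] [∀ n : ℤ, (shiftFunctor T n).Additive] [HasZeroObject T]
  [Pretriangulated T]

lemma yoneda_exact_shift {T₁ : Triangle T} (h : T₁ ∈ distTriang T) {Y : T}
    (f : T₁.obj₁⟦(1 : ℤ)⟧ ⟶ Y) (hf : T₁.mor₃ ≫ f = 0) :
    ∃ g : T₁.obj₂⟦(1 : ℤ)⟧ ⟶ Y, f = T₁.mor₁⟦(1 : ℤ)⟧' ≫ g := by
  obtain ⟨g, hg⟩ := Triangle.yoneda_exact₃ _ (rot_of_distTriang _ h) f hf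
  refine ⟨-g, hg.trans ?_⟩
  exact (Preadditive.neg_comp _ _).trans (Preadditive.comp_neg _ _).symm

lemma exact_leftComp {T₁ : Triangle T} (h : T₁ ∈ distTriang T) (Y : T) :
    Function.Exact (Linear.leftComp R Y T₁.mor₂) (Linear.leftComp R Y T₁.mor₁) := by
  intro f
  constructor
  · intro hf
    obtain ⟨g, hg⟩ := Triangle.yoneda_exact₂ _ h f hf
    exact ⟨g, hg.symm⟩
  · rintro ⟨g, rfl⟩
    simp [comp_distTriang_mor_zero₁₂_assoc _ h]

lemma exact_rightComp {T₁ : Triangle T} (h : T₁ ∈ distTriang T) (Y : T) :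
    Function.Exact (Linear.rightComp R Y T₁.mor₁) (Linear.rightComp R Y T₁.mor₂) := by
  intro f
  constructor
  · intro hf
    obtain ⟨g, hg⟩ := Triangle.coyoneda_exact₂ _ h f hf
    exact ⟨g, hg.symm⟩
  · rintro ⟨g, rfl⟩
    simp [comp_distTriang_mor_zero₁₂ _ h]

/-- The objects at all shifts of which a functional satisfies the condition of a Serre pair. -/
def serreTest {X S : T} (θ : (X ⟶ S) →ₗ[R] E) : ObjectProperty T :=
  fun Y => ∀ n : ℤ, Function.Bijective (serreMap θ (Y⟦n⟧))

instance {X S : T} (θ : (X ⟶ S) →ₗ[R] E) : (serreTest θ).IsClosedUnderIsomorphisms where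
  of_iso e hY n := bijective_serreMap_of_iso ((shiftFunctor T n).mapIso e) (hY n)

/-- Five lemma between the exact sequences `T(-, S)` and `D T(X, -)` of the triangle. -/
lemma bijective_serreMap_of_distTriang (hE : Module.Baer R E) {X S : T} (θ : (X ⟶ S) →ₗ[R] E)
    {T₁ : Triangle T} (h : T₁ ∈ distTriang T) (hθ₁ : serreTest θ T₁.obj₁)
    (hθ₃ : serreTest θ T₁.obj₃) : Function.Bijective (serreMap θ T₁.obj₂) := by
  have zero : ∀ Y, serreTest θ Y → Function.Bijective (serreMap θ Y) := fun Y hY =>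
    bijective_serreMap_of_iso ((shiftFunctorZero T ℤ).app Y) (hY 0)
  refine LinearMap.bijective_of_surjective_of_bijective_of_bijective_of_injective
    (Linear.leftComp R S T₁.mor₃) (Linear.leftComp R S T₁.mor₂) (Linear.leftComp R S T₁.mor₁)
    (Linear.leftComp R S T₁.invRotate.mor₁)
    (LinearMap.lcomp R E (Linear.rightComp R X T₁.mor₃))
    (LinearMap.lcomp R E (Linear.rightComp R X T₁.mor₂))
    (LinearMap.lcomp R E (Linear.rightComp R X T₁.mor₁))
    (LinearMap.lcomp R E (Linear.rightComp R X T₁.invRotate.mor₁))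
    (serreMap θ _) (serreMap θ _) (serreMap θ _) (serreMap θ _) (serreMap θ (T₁.obj₃⟦(-1 : ℤ)⟧))
    ?_ ?_ ?_ ?_ (exact_leftComp (rot_of_distTriang _ h) S) (exact_leftComp h S)
    (exact_leftComp (inv_rot_of_distTriang _ h) S)
    (hE.exact_lcomp (exact_rightComp (rot_of_distTriang _ h) X))
    (hE.exact_lcomp (exact_rightComp h X))
    (hE.exact_lcomp (exact_rightComp (inv_rot_of_distTriang _ h) X))
    (hθ₁ 1).2 (zero _ hθ₃) (zero _ hθ₁) (hθ₃ (-1)).1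
  all_goals
    ext g f
    exact congrArg θ (Category.assoc _ _ _)

/-- This reduces the verification of a Serre pair to objects that generate `T`. -/
theorem serreTest_isTriangulated (hE : Module.Baer R E) {X S : T} (θ : (X ⟶ S) →ₗ[R] E) :
    (serreTest θ).IsTriangulated where
  exists_zero := ⟨_, isZero_zero T, fun n => by
    have h : IsZero ((0 : T)⟦n⟧) := (shiftFunctor T n).map_isZero (isZero_zero T)
    refine ⟨fun _ _ _ => h.eq_of_src _ _, fun φ => ⟨0, ?_⟩⟩
    ext f
    rw [h.eq_of_tgt f 0, map_zero, map_zero]⟩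
  isStableUnderShiftBy n := ⟨fun Y hY m =>
    bijective_serreMap_of_iso ((shiftFunctorAdd T n m).app Y) (hY (n + m))⟩
  toIsTriangulatedClosed₂ := .mk' (P := serreTest θ) fun T₁ h hθ₁ hθ₃ n =>
    bijective_serreMap_of_distTriang hE θ (Triangle.shift_distinguished _ h n)
      (fun m => bijective_serreMap_of_iso ((shiftFunctorAdd T n m).app _) (hθ₁ (n + m)))
      (fun m => bijective_serreMap_of_iso ((shiftFunctorAdd T n m).app _) (hθ₃ (n + m)))

end

variable [HasShift T ℤ] [∀ n : ℤ, (shiftFunctor T n).Additive]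
  [∀ n : ℤ, (shiftFunctor T n).Linear R]

/-- The transport of a functional along a shift functor. -/
noncomputable def shiftFunctional {X S : T} (θ : (X ⟶ S) →ₗ[R] E) (n : ℤ) :
    (X⟦n⟧ ⟶ S⟦n⟧) →ₗ[R] E :=
  θ ∘ₗ (LinearEquiv.ofBijective ((shiftFunctor T n).mapLinearMap R)
    ((Functor.FullyFaithful.ofFullyFaithful (shiftFunctor T n)).map_bijective X S)).symm.toLinearMap

@[simp] lemma shiftFunctional_map {X S : T} (θ : (X ⟶ S) →ₗ[R] E) (n : ℤ) (f : X ⟶ S) :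
    shiftFunctional θ n (f⟦n⟧') = θ f :=
  congrArg θ (LinearEquiv.symm_apply_apply (LinearEquiv.ofBijective
    ((shiftFunctor T n).mapLinearMap R)
    ((Functor.FullyFaithful.ofFullyFaithful (shiftFunctor T n)).map_bijective X S)) f)

lemma IsSerrePair.shift {X S : T} {θ : (X ⟶ S) →ₗ[R] E} (hθ : IsSerrePair θ) (n : ℤ) :
    IsSerrePair (shiftFunctional θ n) := by
  suffices h : ∀ Z : T, Function.Bijective (serreMap (shiftFunctional θ n) (Z⟦n⟧)) from
    fun Y => bijective_serreMap_of_iso ((shiftEquiv T n).counitIso.app Y) (h _)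
  refine fun Z => ⟨fun g g' hg => ?_, fun φ => ?_⟩
  · obtain ⟨g, rfl⟩ := (shiftFunctor T n).map_surjective g
    obtain ⟨g', rfl⟩ := (shiftFunctor T n).map_surjective g'
    congr 1
    refine hθ.ext fun f => ?_
    have := DFunLike.congr_fun hg (f⟦n⟧')
    simpa only [serreMap_apply, ← Functor.map_comp, shiftFunctional_map] using this
  · obtain ⟨g, hg⟩ := hθ.surjective (φ ∘ₗ (shiftFunctor T n).mapLinearMap R)
    refine ⟨g⟦n⟧', ?_⟩
    ext f
    obtain ⟨f, rfl⟩ := (shiftFunctor T n).map_surjective f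
    rw [serreMap_apply, ← Functor.map_comp, shiftFunctional_map]
    exact hg f

instance : (hasSerreDual R E T).IsStableUnderShift ℤ where
  isStableUnderShiftBy n := ⟨by
    rintro X ⟨S, θ, hθ⟩
    exact ⟨_, _, hθ.shift n⟩⟩

instance : (isSerreDual R E T).IsStableUnderShift ℤ where
  isStableUnderShiftBy n := ⟨by
    rintro X ⟨S, θ, hθ⟩
    exact ⟨_, _, hθ.shift n⟩⟩

variable [HasZeroObject T] [Pretriangulated T]

section

variable {T₁ T₂ : Triangle T} (h₁ : T₁ ∈ distTriang T) (h₂ : T₂ ∈ distTriang T)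
  (θ₁ : (T₁.obj₁ ⟶ T₂.obj₁) →ₗ[R] E) (θ₂ : (T₁.obj₂ ⟶ T₂.obj₂) →ₗ[R] E)
  (hθ : ∀ g : T₁.obj₂ ⟶ T₂.obj₁, θ₂ (g ≫ T₂.mor₁) = θ₁ (T₁.mor₁ ≫ g))

include h₁ h₂ hθ

/-- The conditions prescribe `θ₃` on the morphisms `g ≫ T₂.mor₂` and `T₁.mor₃ ≫ g`. Once they agree
on overlaps, injectivity of `E` extends the prescription. The sign compensates the one in the
rotated triangle. -/
lemma exists_functional_of_distTriang (hE : Module.Baer R E) :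
    ∃ θ₃ : (T₁.obj₃ ⟶ T₂.obj₃) →ₗ[R] E,
      (∀ g : T₁.obj₃ ⟶ T₂.obj₂, θ₃ (g ≫ T₂.mor₂) = θ₂ (T₁.mor₂ ≫ g)) ∧
      (∀ g : T₁.obj₁⟦(1 : ℤ)⟧ ⟶ T₂.obj₃,
        θ₃ (T₁.mor₃ ≫ g) = -shiftFunctional θ₁ 1 (g ≫ T₂.mor₃)) := by
  let a : ((T₁.obj₃ ⟶ T₂.obj₂) × (T₁.obj₁⟦(1 : ℤ)⟧ ⟶ T₂.obj₃)) →ₗ[R] (T₁.obj₃ ⟶ T₂.obj₃) :=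
    (Linear.rightComp R _ T₂.mor₂).coprod (Linear.leftComp R _ T₁.mor₃)
  let φ : ((T₁.obj₃ ⟶ T₂.obj₂) × (T₁.obj₁⟦(1 : ℤ)⟧ ⟶ T₂.obj₃)) →ₗ[R] E :=
    (θ₂ ∘ₗ Linear.leftComp R _ T₁.mor₂).coprod
      (-(shiftFunctional θ₁ 1 ∘ₗ Linear.rightComp R _ T₂.mor₃))
  have key : ∀ x, a x = 0 → φ x = 0 := by
    rintro ⟨b, c⟩ h
    change b ≫ T₂.mor₂ + T₁.mor₃ ≫ c = 0 at h
    change θ₂ (T₁.mor₂ ≫ b) + -shiftFunctional θ₁ 1 (c ≫ T₂.mor₃) = 0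
    -- Lift `T₁.mor₂ ≫ b` to `d` and complete `(d, b)` to a morphism of triangles with third
    -- component `c'`. Then `c + c'` factors through `T₁.mor₁⟦1⟧'`, and this correction contributes
    -- nothing because `T₂.mor₃ ≫ T₂.mor₁⟦1⟧' = 0`.
    obtain ⟨d, hd⟩ := Triangle.coyoneda_exact₂ _ h₂ (T₁.mor₂ ≫ b) (by
      have := T₁.mor₂ ≫= h
      rwa [Preadditive.comp_add, comp_distTriang_mor_zero₂₃_assoc _ h₁, zero_comp, add_zero,
        comp_zero, ← Category.assoc] at this)
    obtain ⟨c' : T₁.obj₁⟦(1 : ℤ)⟧ ⟶ T₂.obj₃, hc₁, hc₂⟩ := complete_distinguished_triangle_morphism _ _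
      (rot_of_distTriang _ h₁) h₂ d b hd
    have hc₂ : (-T₁.mor₁⟦(1 : ℤ)⟧') ≫ d⟦(1 : ℤ)⟧' = c' ≫ T₂.mor₃ := hc₂
    have hc₁ : T₁.mor₃ ≫ c' = b ≫ T₂.mor₂ := hc₁
    obtain ⟨e, he⟩ := yoneda_exact_shift h₁ (c + c') (by
      rw [Preadditive.comp_add, hc₁, add_comm, h])
    have h0 : shiftFunctional θ₁ 1 (T₁.mor₁⟦(1 : ℤ)⟧' ≫ e ≫ T₂.mor₃) = 0 := by
      obtain ⟨e', he'⟩ := (shiftFunctor T (1 : ℤ)).map_surjective (e ≫ T₂.mor₃)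
      rw [← he', ← Functor.map_comp, shiftFunctional_map, ← hθ, ← shiftFunctional_map _ 1,
        Functor.map_comp, he', Category.assoc, comp_distTriang_mor_zero₃₁ _ h₂, comp_zero, map_zero]
    have hc : c = -c' + T₁.mor₁⟦(1 : ℤ)⟧' ≫ e := by
      rw [← he]
      abel
    rw [hd, hθ, hc, Preadditive.add_comp, map_add, Category.assoc, h0, add_zero,
      Preadditive.neg_comp, ← hc₂, Preadditive.neg_comp, neg_neg, ← Functor.map_comp,
      shiftFunctional_map, add_neg_cancel]
  obtain ⟨ψ, hψ⟩ := hE.exists_comp_eq a φ key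
  refine ⟨ψ, fun g => ?_, fun g => ?_⟩
  · simpa [a, φ] using DFunLike.congr_fun hψ (g, 0)
  · simpa [a, φ] using DFunLike.congr_fun hψ (0, g)

/-- Five lemma between `T(Y, -)` on `T₂` and `D T(-, Y)` on `T₁`; the conditions on `θ₃` are exactly
the commutativity of the two squares next to it. -/
lemma exists_isSerrePair_of_distTriang (hE : Module.Baer R E) (hp₁ : IsSerrePair θ₁)
    (hp₂ : IsSerrePair θ₂) : ∃ θ₃ : (T₁.obj₃ ⟶ T₂.obj₃) →ₗ[R] E, IsSerrePair θ₃ := by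
  obtain ⟨θ₃, hθ₃, hθ₃'⟩ := exists_functional_of_distTriang h₁ h₂ θ₁ θ₂ hθ hE
  refine ⟨θ₃, fun Y => ?_⟩
  refine LinearMap.bijective_of_surjective_of_bijective_of_bijective_of_injective
    (Linear.rightComp R Y T₂.mor₁) (Linear.rightComp R Y T₂.mor₂) (Linear.rightComp R Y T₂.mor₃)
    (Linear.rightComp R Y (-T₂.mor₁⟦(1 : ℤ)⟧'))
    (LinearMap.lcomp R E (Linear.leftComp R Y T₁.mor₁)) _ _
    (LinearMap.lcomp R E (Linear.leftComp R Y (-T₁.mor₁⟦(1 : ℤ)⟧')))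
    (serreMap θ₁ Y) (serreMap θ₂ Y) (serreMap θ₃ Y) (serreMap (-shiftFunctional θ₁ 1) Y)
    (serreMap (-shiftFunctional θ₂ 1) Y) ?_ ?_ ?_ ?_ ?_ ?_ ?_
    (hE.exact_lcomp (exact_leftComp h₁ Y)) (hE.exact_lcomp (exact_leftComp (rot_of_distTriang _ h₁) Y))
    (hE.exact_lcomp (f := Linear.leftComp R Y (-T₁.mor₁⟦(1 : ℤ)⟧'))
      (exact_leftComp (rot_of_distTriang _ (rot_of_distTriang _ h₁)) Y)) (hp₁ Y).2 (hp₂ Y)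
    ((hp₁.shift 1).neg Y) ((hp₂.shift 1).neg Y).1
  · ext g f
    simp [← hθ]
  · ext g f
    simp [← hθ₃]
  · ext g f
    change θ₃ ((T₁.mor₃ ≫ f) ≫ g) = -shiftFunctional θ₁ 1 (f ≫ g ≫ T₂.mor₃)
    rw [Category.assoc, hθ₃', Category.assoc]
  · ext g f
    obtain ⟨k, hk⟩ := (shiftFunctor T (1 : ℤ)).map_surjective (f ≫ g)
    have : (shiftFunctional θ₂ 1) (k⟦(1 : ℤ)⟧' ≫ T₂.mor₁⟦(1 : ℤ)⟧') =
        (shiftFunctional θ₁ 1) (T₁.mor₁⟦(1 : ℤ)⟧' ≫ k⟦(1 : ℤ)⟧') := by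
      rw [← Functor.map_comp, ← Functor.map_comp, shiftFunctional_map, shiftFunctional_map, hθ]
    simp only [hk, Category.assoc] at this
    simp [this]
  · exact exact_rightComp h₂ Y
  · exact exact_rightComp (rot_of_distTriang _ h₂) Y
  · exact exact_rightComp (rot_of_distTriang _ (rot_of_distTriang _ h₂)) Y

end

/-- The Serre dual of a cone is the cone of the dual morphism `m`. -/
theorem hasSerreDual_isTriangulated (hE : Module.Baer R E) :
    (hasSerreDual R E T).IsTriangulated where
  exists_zero := ⟨_, isZero_zero T, _, _, isSerrePair_of_isZero (isZero_zero T) (isZero_zero T)⟩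
  toIsTriangulatedClosed₂ :=
    have : (hasSerreDual R E T).IsTriangulatedClosed₃ := .mk' fun T₁ h₁ => by
      rintro ⟨S₁, θ₁, hp₁⟩ ⟨S₂, θ₂, hp₂⟩
      obtain ⟨m, hm⟩ := hp₂.surjective (θ₁ ∘ₗ Linear.leftComp R S₁ T₁.mor₁)
      obtain ⟨S₃, a, b, h₂⟩ := distinguished_cocone_triangle m
      obtain ⟨θ₃, hp₃⟩ := exists_isSerrePair_of_distTriang h₁ h₂ θ₁ θ₂ hm hE hp₁ hp₂
      exact ⟨S₃, θ₃, hp₃⟩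
    .of_isTriangulatedClosed₃

/-- Here a morphism between the duals has to be transported back to the `X`'s, which uses
`IsSerrePair.bijective_left` and hence reflexivity. -/
theorem isSerreDual_isTriangulated (hE : IsMatlisDualizing.{w, v, w} R E) (hT : IsHomFinite R T) :
    (isSerreDual R E T).IsTriangulated where
  exists_zero := ⟨_, isZero_zero T, _, _, isSerrePair_of_isZero (isZero_zero T) (isZero_zero T)⟩
  toIsTriangulatedClosed₂ :=
    have : (isSerreDual R E T).IsTriangulatedClosed₃ := .mk' fun T₂ h₂ => by
      rintro ⟨X₁, θ₁, hp₁⟩ ⟨X₂, θ₂, hp₂⟩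
      obtain ⟨m, hm⟩ := (hp₁.bijective_left hE hT X₂).2 (θ₂ ∘ₗ Linear.rightComp R X₂ T₂.mor₁)
      obtain ⟨X₃, a, b, h₁⟩ := distinguished_cocone_triangle m
      obtain ⟨θ₃, hp₃⟩ := exists_isSerrePair_of_distTriang h₁ h₂ θ₁ θ₂
        (fun g => (DFunLike.congr_fun hm g).symm) hE.baer hp₁ hp₂
      exact ⟨X₃, θ₃, hp₃⟩
    .of_isTriangulatedClosed₃

end TriangulatedSerrePair

/-! ### The triangulated category of bounded complexes up to homotopy -/

section FullSubcategoryTriangulated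

open Pretriangulated

variable {T : Type u} [Category.{v} T] [Preadditive T] [HasShift T ℤ]
  [∀ n : ℤ, (shiftFunctor T n).Additive]

instance fullSubcategory_shift_linear {R : Type w} [CommRing R] [Linear R T]
    [∀ n : ℤ, (shiftFunctor T n).Linear R] (P : ObjectProperty T) [P.IsStableUnderShift ℤ] (n : ℤ) :
    (shiftFunctor P.FullSubcategory n).Linear R where
  map_smul f r := by
    apply P.ι.map_injective
    rw [← cancel_mono ((P.ι.commShiftIso n).hom.app _)]
    erw [P.ι.commShiftIso_hom_naturality]
    rw [P.ι.map_smul, P.ι.map_smul, Functor.map_smul, Linear.comp_smul, Linear.smul_comp,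
      P.ι.commShiftIso_hom_naturality]

variable [HasZeroObject T] [Pretriangulated T]

lemma exists_distTriang_fullSubcategory (P : ObjectProperty T) [P.IsTriangulated]
    {A X B : P.FullSubcategory} (f : A.obj ⟶ X.obj) (g : X.obj ⟶ B.obj)
    (h : B.obj ⟶ A.obj⟦(1 : ℤ)⟧) (hT : Triangle.mk f g h ∈ distTriang T) :
    ∃ (f' : A ⟶ X) (g' : X ⟶ B) (h' : B ⟶ A⟦(1 : ℤ)⟧),
      Triangle.mk f' g' h' ∈ distTriang P.FullSubcategory := by
  refine ⟨P.fullyFaithfulι.preimage f, P.fullyFaithfulι.preimage g,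
    P.fullyFaithfulι.preimage (h ≫ (P.ι.commShiftIso (1 : ℤ)).inv.app A),
    isomorphic_distinguished _ hT _ (Triangle.isoMk _ _ (Iso.refl _) (Iso.refl _) (Iso.refl _)
      ?_ ?_ ?_)⟩
  · exact (Category.comp_id _).trans (Category.id_comp _).symm
  · exact (Category.comp_id _).trans (Category.id_comp _).symm
  · have key : ∀ {W X Y : T} (h : W ⟶ X) (i : X ⟶ Y) (j : Y ⟶ X) (k : X ⟶ X),
        i ≫ j = 𝟙 X → k = 𝟙 X → ((h ≫ i) ≫ j) ≫ k = 𝟙 W ≫ h := by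
      rintro W X Y h i j _ hij rfl
      rw [Category.comp_id, Category.assoc, hij, Category.comp_id, Category.id_comp]
    refine key h ((P.ι.commShiftIso (1 : ℤ)).inv.app A) _ _ ?_
      ((shiftFunctor T (1 : ℤ)).map_id A.obj)
    exact (P.ι.commShiftIso (1 : ℤ)).inv_hom_id_app A

end FullSubcategoryTriangulated

section Bounded

open Pretriangulated ZeroObject

variable {C : Type u} [Category.{v} C] [Preadditive C]

instance [HasZeroObject C] : (isBoundedComplex C).ContainsZero where
  exists_zero := ⟨(HomotopyCategory.quotient _ _).obj 0, Functor.map_isZero _ (isZero_zero _),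
    0, 0, fun i _ => (HomologicalComplex.eval C _ i).map_isZero (isZero_zero _)⟩

instance : (isBoundedComplex C).IsStableUnderShift ℤ where
  isStableUnderShiftBy n :=
    { le_shift K hK := by
        obtain ⟨K, rfl⟩ := HomotopyCategory.quotient_obj_surjective K
        obtain ⟨a, b, h⟩ := hK
        rw [ObjectProperty.prop_shift_iff, HomotopyCategory.shift_quotient_obj]
        exact ⟨a - n, b - n, fun i hi => h (i + n) (by lia)⟩ }

variable [HasZeroObject C] [HasBinaryBiproducts C]

/-- A morphism lifts to a chain map, so the third vertex is isomorphic to a mapping cone, whose term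
in degree `i` involves degree `i + 1` of the source and degree `i` of the target. -/
instance : (isBoundedComplex C).IsTriangulatedClosed₃ where
  ext₃' T hT h₁ h₂ := by
    obtain ⟨a₁, b₁, h₁⟩ := h₁
    obtain ⟨a₂, b₂, h₂⟩ := h₂
    obtain ⟨f : T.obj₁.as ⟶ T.obj₂.as, hf⟩ :=
      (HomotopyCategory.quotient C (.up ℤ)).map_surjective T.mor₁
    refine ⟨_, ?_,
      ⟨Triangle.π₃.mapIso (isoTriangleOfIso₁₂ T _ hT
        (HomotopyCategory.mappingCone_triangleh_distinguished f)
        (Iso.refl _) (Iso.refl _) ?_)⟩⟩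
    · refine ⟨min (a₁ - 1) a₂, max (b₁ - 1) b₂, fun i hi => ?_⟩
      change IsZero ((CochainComplex.mappingCone f).X i)
      rw [CochainComplex.mappingCone.isZero_X_iff]
      exact ⟨h₁ _ (by lia), h₂ _ (by lia)⟩
    · change T.mor₁ ≫ 𝟙 _ = 𝟙 _ ≫ (HomotopyCategory.quotient C (.up ℤ)).map f
      rw [Category.comp_id, Category.id_comp, hf]

instance : (isBoundedComplex C).IsTriangulated where
  toIsTriangulatedClosed₂ := .of_isTriangulatedClosed₃

variable (C) in
/-- The stalk complex of `M` in degree `n`, as an object of `K^b(C)`. -/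
noncomputable def Kb.single (n : ℤ) : C ⥤ Kb C :=
  (isBoundedComplex C).lift (HomotopyCategory.singleFunctor C n) fun M =>
    ⟨n, n, fun _ hi => HomologicalComplex.isZero_single_obj_X _ _ _ _ (by lia)⟩

/-- The bounded complexes as objects of `K^b(C)`. -/
def Kb.of (K : CochainComplex C ℤ) (hK : ∃ a b : ℤ, ∀ i : ℤ, i < a ∨ b < i → IsZero (K.X i)) :
    Kb C :=
  ⟨(HomotopyCategory.quotient _ _).obj K, hK⟩

/-- The shift of a stalk complex is a stalk complex. -/
noncomputable def Kb.singleShiftIso (M : C) (n i j : ℤ) (h : n + j = i) :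
    ((Kb.single C i).obj M)⟦n⟧ ≅ (Kb.single C j).obj M :=
  (isBoundedComplex C).isoMk (((isBoundedComplex C).ι.commShiftIso n).app _ ≪≫
    ((HomotopyCategory.singleFunctors C).shiftIso n j i h).app M)

lemma Kb.prop_single (Q : ObjectProperty (Kb C)) [Q.IsStableUnderShift ℤ]
    [Q.IsClosedUnderIsomorphisms] (M : C) (i j : ℤ) (h : Q ((Kb.single C i).obj M)) :
    Q ((Kb.single C j).obj M) :=
  Q.prop_of_iso (Kb.singleShiftIso M (i - j) i j (by lia)) (Q.le_shift _ _ h)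

namespace CochainComplex

variable (K : CochainComplex C ℤ) (b : ℤ)

open scoped Classical in
/-- The terms of the brutal truncation of a complex to degrees `< b`. -/
noncomputable def brutalX (i : ℤ) : C := if i < b then K.X i else 0

noncomputable def brutalπ (i : ℤ) : K.X i ⟶ brutalX K b i :=
  if h : i < b then eqToHom (by simp [brutalX, h]) else 0

/-- A degreewise section of `brutalπ` that need not commute with the differentials. -/
noncomputable def brutalσ (i : ℤ) : brutalX K b i ⟶ K.X i :=
  if h : i < b then eqToHom (by simp [brutalX, h]) else 0

lemma isZero_brutalX {i : ℤ} (h : ¬ i < b) : IsZero (brutalX K b i) := by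
  simpa [brutalX, h] using isZero_zero C

lemma brutalπ_σ {i : ℤ} (h : i < b) : brutalπ K b i ≫ brutalσ K b i = 𝟙 _ := by
  simp [brutalπ, brutalσ, h]

lemma brutalπ_σ_assoc {i : ℤ} (h : i < b) {Z : C} (f : K.X i ⟶ Z) :
    brutalπ K b i ≫ brutalσ K b i ≫ f = f := by
  rw [← Category.assoc, brutalπ_σ K b h, Category.id_comp]

@[simp]
lemma brutalσ_π (i : ℤ) : brutalσ K b i ≫ brutalπ K b i = 𝟙 _ := by
  by_cases h : i < b
  · simp [brutalπ, brutalσ, h]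
  · exact (isZero_brutalX K b h).eq_of_src _ _

/-- The brutal truncation of a complex to degrees `< b`. -/
@[simps]
noncomputable def brutal : CochainComplex C ℤ where
  X := brutalX K b
  d i j := brutalσ K b i ≫ K.d i j ≫ brutalπ K b j
  shape i j h := by simp [K.shape i j h]
  d_comp_d' i j k _ _ := by
    by_cases h : j < b
    · simp [brutalπ_σ_assoc K b h]
    · have := (isZero_brutalX K b h).eq_of_tgt (brutalπ K b j) 0
      simp [this]

/-- The projection onto the brutal truncation. -/
@[simps]
noncomputable def toBrutal : K ⟶ brutal K b where
  f := brutalπ K b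
  comm' i j hij := by
    by_cases h : i < b
    · exact brutalπ_σ_assoc K b h _
    · have hj : ¬ j < b := by
        simp only [ComplexShape.up_Rel] at hij
        lia
      exact (isZero_brutalX K b hj).eq_of_tgt _ _

variable (hb : ∀ i, b < i → IsZero (K.X i))

/-- The inclusion of the top term of a complex. -/
noncomputable def ofTop : (HomologicalComplex.single C (.up ℤ) b).obj (K.X b) ⟶ K :=
  HomologicalComplex.mkHomFromSingle (𝟙 _) fun i hi => by
    simp only [ComplexShape.up_Rel] at hi
    exact (hb i (by lia)).eq_of_tgt _ _

/-- The degreewise split exact sequence given by the top term of a complex. -/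
@[simps]
noncomputable def topShortComplex : ShortComplex (CochainComplex C ℤ) where
  f := ofTop K b hb
  g := toBrutal K b
  zero := by
    refine HomologicalComplex.hom_ext _ _ fun i => ?_
    by_cases h : i = b
    · exact (isZero_brutalX K b (by lia)).eq_of_tgt _ _
    · exact (HomologicalComplex.isZero_single_obj_X _ _ _ _ h).eq_of_src _ _

/-- The retraction of the inclusion of the top term of a complex. -/
noncomputable def topRetraction (i : ℤ) : K.X i ⟶ ((HomologicalComplex.single C (.up ℤ) b).obj (K.X b)).X i :=
  if h : i = b then (K.XIsoOfEq h).hom ≫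
    (HomologicalComplex.singleObjXIsoOfEq (.up ℤ) b (K.X b) i h).inv else 0

lemma ofTop_f_self :
    (ofTop K b hb).f b = (HomologicalComplex.singleObjXSelf (.up ℤ) b (K.X b)).hom := by
  rw [ofTop, HomologicalComplex.mkHomFromSingle_f, Category.comp_id]

lemma topRetraction_self :
    topRetraction K b b = (HomologicalComplex.singleObjXSelf (.up ℤ) b (K.X b)).inv := by
  rw [topRetraction, dif_pos rfl, HomologicalComplex.XIsoOfEq_rfl, Iso.refl_hom, Category.id_comp]
  rfl

/-- The splitting of `topShortComplex`. -/
noncomputable def topSplitting (i : ℤ) :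
    ((topShortComplex K b hb).map (HomologicalComplex.eval C _ i)).Splitting where
  r := topRetraction K b i
  s := brutalσ K b i
  f_r := by
    change (ofTop K b hb).f i ≫ topRetraction K b i = 𝟙 _
    by_cases h : i = b
    · subst h
      rw [ofTop_f_self, topRetraction_self, Iso.hom_inv_id]
    · exact (HomologicalComplex.isZero_single_obj_X _ _ _ _ h).eq_of_src _ _
  s_g := brutalσ_π K b i
  id := by
    change topRetraction K b i ≫ (ofTop K b hb).f i + brutalπ K b i ≫ brutalσ K b i = 𝟙 (K.X i)
    rcases lt_trichotomy i b with h | h | h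
    · rw [topRetraction, dif_neg h.ne, zero_comp, zero_add]
      exact brutalπ_σ K b h
    · subst h
      rw [(isZero_brutalX K i (lt_irrefl i)).eq_of_src (brutalσ K i i) 0,
        comp_zero, add_zero, ofTop_f_self, topRetraction_self, Iso.inv_hom_id]
    · exact (hb i h).eq_of_src _ _

end CochainComplex

/-! ### Dévissage of bounded complexes into stalk complexes -/

section Devissage

open CochainComplex

lemma isBounded_brutal {K : CochainComplex C ℤ} (b : ℤ)
    (hK : ∃ a b : ℤ, ∀ i : ℤ, i < a ∨ b < i → IsZero (K.X i)) :
    ∃ a b' : ℤ, ∀ i : ℤ, i < a ∨ b' < i → IsZero ((brutal K b).X i) := by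
  obtain ⟨a, b', h⟩ := hK
  refine ⟨a, b', fun i hi => ?_⟩
  by_cases hi' : i < b
  · simpa [brutalX, hi'] using h i hi
  · exact isZero_brutalX K b hi'

/-- The top term is a subcomplex with quotient the brutal truncation, and a degreewise split
sequence yields a triangle up to homotopy. -/
lemma Kb.exists_distTriang_top (K : CochainComplex C ℤ) (b : ℤ)
    (hK : ∃ a b : ℤ, ∀ i : ℤ, i < a ∨ b < i → IsZero (K.X i))
    (hb : ∀ i, b < i → IsZero (K.X i)) :
    ∃ (f : (Kb.single C b).obj (K.X b) ⟶ Kb.of K hK)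
      (g : Kb.of K hK ⟶ Kb.of (brutal K b) (isBounded_brutal b hK)) (h : _),
      Triangle.mk f g h ∈ distTriang (Kb C) := by
  have := (HomotopyCategory.distinguished_iff_iso_trianglehOfDegreewiseSplit _).2
    ⟨topShortComplex K b hb, topSplitting K b hb, ⟨Iso.refl _⟩⟩
  exact exists_distTriang_fullSubcategory (isBoundedComplex C) (A := (Kb.single C b).obj (K.X b))
    (X := Kb.of K hK) (B := Kb.of (brutal K b) (isBounded_brutal b hK)) _ _ _ this

variable (Q : ObjectProperty (Kb C)) [Q.IsTriangulated] [Q.IsClosedUnderIsomorphisms]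

lemma Kb.prop_of_isZero {X : Kb C} (hX : IsZero X) : Q X := by
  obtain ⟨Z, hZ, h⟩ := Q.exists_prop_of_containsZero
  exact Q.prop_of_iso (hZ.iso hX) h

lemma Kb.prop_single_zero {M : C} (hM : IsZero M) (i : ℤ) : Q ((Kb.single C i).obj M) := by
  apply Kb.prop_of_isZero
  rw [IsZero.iff_id_eq_zero]
  ext
  exact ((HomotopyCategory.singleFunctor C i).map_isZero hM).eq_of_src _ _

lemma Kb.isZero_of {K : CochainComplex C ℤ} (hK) (h : ∀ i, IsZero (K.X i)) :
    IsZero (Kb.of K hK) := by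
  rw [IsZero.iff_id_eq_zero]
  ext
  refine ((HomotopyCategory.quotient C (.up ℤ)).map_isZero (X := K) ?_).eq_of_src _ _
  rw [IsZero.iff_id_eq_zero]
  ext i
  exact (h i).eq_of_src _ _

/-- Dévissage: a triangulated subcategory of `K^b(C)` which contains all terms of a complex, except
possibly one, contains this complex if and only if it contains the remaining term. -/
lemma Kb.devissage (K : CochainComplex C ℤ)
    (hK : ∃ a b : ℤ, ∀ i : ℤ, i < a ∨ b < i → IsZero (K.X i)) (i₀ : ℤ)
    (h : ∀ i ≠ i₀, Q ((Kb.single C i).obj (K.X i))) :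
    Q (Kb.of K hK) ↔ Q ((Kb.single C i₀).obj (K.X i₀)) := by
  obtain ⟨a, b, hab⟩ := id hK
  -- Induct on the width of the window `[a, a + n)` that contains all nonzero terms, stripping off
  -- the top term.
  have main : ∀ (n : ℕ) (K : CochainComplex C ℤ)
      (hK : ∃ a b : ℤ, ∀ i : ℤ, i < a ∨ b < i → IsZero (K.X i))
      (_ : ∀ i ≠ i₀, Q ((Kb.single C i).obj (K.X i)))
      (_ : ∀ i : ℤ, i < a ∨ a + n ≤ i → IsZero (K.X i)),
      Q (Kb.of K hK) ↔ Q ((Kb.single C i₀).obj (K.X i₀)) := by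
    intro n
    induction n with
    | zero =>
      intro K hK h hn
      have hz : ∀ i, IsZero (K.X i) := fun i => hn i (by lia)
      exact iff_of_true (Kb.prop_of_isZero Q (Kb.isZero_of hK hz)) (Kb.prop_single_zero Q (hz _) _)
    | succ n ih =>
      intro K hK h hn
      have hb : ∀ i, a + n < i → IsZero (K.X i) := fun i hi => hn i (by lia)
      obtain ⟨f, g, k, hT⟩ := Kb.exists_distTriang_top K (a + n) hK hb
      have hX : ∀ i < a + n, (brutal K (a + n)).X i = K.X i := fun i hi => by
        simp [brutalX, hi]
      have hz : ∀ i, ¬ i < a + n → IsZero ((brutal K (a + n)).X i) :=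
        fun i hi => isZero_brutalX K _ hi
      have ih' := ih (brutal K (a + n)) (isBounded_brutal _ hK) (fun i hi => by
          by_cases hi' : i < a + n
          · rw [hX i hi']
            exact h i hi
          · exact Kb.prop_single_zero Q (hz i hi') i) (fun i hi => by
          by_cases hi' : i < a + n
          · rw [hX i hi']
            exact hn i (by lia)
          · exact hz i hi')
      -- If the top term is the exceptional one, the truncation lies in `Q` and `K` is equivalent to
      -- its top term; otherwise the top term lies in `Q` and can be dropped.
      by_cases hi₀ : i₀ = a + n
      · subst hi₀
        have hq := ih'.2 (Kb.prop_single_zero Q (hz _ (lt_irrefl _)) _)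
        exact ⟨fun h' => Q.ext_of_isTriangulatedClosed₁ _ hT h' hq,
          fun h' => Q.ext_of_isTriangulatedClosed₂ _ hT h' hq⟩
      · have hq := h _ (Ne.symm hi₀)
        have : Q (Kb.of K hK) ↔ Q (Kb.of (brutal K (a + n)) (isBounded_brutal _ hK)) :=
          ⟨fun h' => Q.ext_of_isTriangulatedClosed₃ _ hT hq h',
          fun h' => Q.ext_of_isTriangulatedClosed₂ _ hT hq h'⟩
        rw [this, ih']
        by_cases hi₀' : i₀ < a + n
        · rw [hX i₀ hi₀']
        · exact iff_of_true (Kb.prop_single_zero Q (hz _ hi₀') _)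
            (Kb.prop_single_zero Q (hb _ (by lia)) _)
  exact main (b + 1 - a).toNat K hK h (fun i hi => hab i (by lia))

theorem Kb.prop_of_single (h : ∀ M, Q ((Kb.single C 0).obj M)) (X : Kb C) : Q X := by
  have h' : ∀ i M, Q ((Kb.single C i).obj M) := fun i M => Kb.prop_single Q M 0 i (h M)
  exact (Kb.devissage Q X.obj.as X.property 0 (fun i _ => h' i _)).2 (h' 0 _)

end Devissage

end Bounded

/-! ### Serre duals of stalk complexes -/

section FromSingle

open CochainComplex.HomComplex

variable {C : Type u} [Category.{v} C] [Preadditive C] [HasZeroObject C] [HasBinaryBiproducts C]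
  {K : CochainComplex C ℤ} {hK : ∃ a b : ℤ, ∀ i : ℤ, i < a ∨ b < i → IsZero (K.X i)}
  {M : C} {n : ℤ}

/-- The morphism from a stalk complex given by a cycle. -/
noncomputable def Kb.fromSingle (hK : ∃ a b : ℤ, ∀ i : ℤ, i < a ∨ b < i → IsZero (K.X i))
    (φ : M ⟶ K.X n) (hφ : φ ≫ K.d n (n + 1) = 0) : (Kb.single C n).obj M ⟶ Kb.of K hK :=
  ObjectProperty.homMk ((HomotopyCategory.quotient _ _).map
    (Cocycle.fromSingleMk φ (add_zero n) (n + 1) rfl hφ).homOf)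

/-- With `Kb.fromSingle_eq_zero_iff` this computes the morphisms from `M` in degree `n` to `K` as
the `n`-th cohomology of `Hom(M, K)`. -/
lemma Kb.fromSingle_surjective (f : (Kb.single C n).obj M ⟶ Kb.of K hK) :
    ∃ (φ : M ⟶ K.X n) (hφ : φ ≫ K.d n (n + 1) = 0), Kb.fromSingle hK φ hφ = f := by
  obtain ⟨g, hg⟩ := (HomotopyCategory.quotient _ _).map_surjective f.hom
  obtain ⟨φ, hφ, h⟩ := Cocycle.fromSingleMk_surjective (Cocycle.ofHom g) n (add_zero n) _ rfl
  refine ⟨φ, hφ, ?_⟩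
  ext
  rw [← hg, Kb.fromSingle, h, Cocycle.homOf_ofHom_eq_self]
  rfl

lemma Kb.fromSingle_eq_zero_iff (φ : M ⟶ K.X n) (hφ : φ ≫ K.d n (n + 1) = 0) (m : ℤ)
    (hm : m + 1 = n) : Kb.fromSingle hK φ hφ = 0 ↔ ∃ h : M ⟶ K.X m, h ≫ K.d m n = φ := by
  rw [← Cocycle.fromSingleMk_mem_coboundaries_iff φ (add_zero n) (n + 1) rfl hφ m hm,
    mem_coboundaries_iff _ (-1) (by simp)]
  have : Kb.fromSingle hK φ hφ = 0 ↔ (HomotopyCategory.quotient _ _).map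
    (Cocycle.fromSingleMk φ (add_zero n) (n + 1) rfl hφ).homOf = 0 :=
    ⟨fun h => congrArg (fun f => f.hom) h, fun h => by ext; exact h⟩
  rw [this, HomotopyCategory.quotient_map_eq_zero_iff,
    (Cochain.equivHomotopy _ _).nonempty_congr]
  constructor
  · rintro ⟨z, hz⟩
    exact ⟨z, by simpa using hz.symm⟩
  · rintro ⟨z, hz⟩
    exact ⟨z, by simpa using hz.symm⟩

lemma Kb.single_map_fromSingle {M' : C} (g : M' ⟶ M) (φ : M ⟶ K.X n)
    (hφ : φ ≫ K.d n (n + 1) = 0) : (Kb.single C n).map g ≫ Kb.fromSingle hK φ hφ =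
      Kb.fromSingle hK (g ≫ φ) (by rw [Category.assoc, hφ, comp_zero]) := by
  ext
  change (HomotopyCategory.quotient _ _).map ((CochainComplex.singleFunctor C n).map g) ≫
    (HomotopyCategory.quotient _ _).map _ = (HomotopyCategory.quotient _ _).map _
  rw [← Functor.map_comp, Cocycle.fromSingleMk_precomp _ _ _ _ _ hφ]
  congr 1
  apply (Cocycle.equivHom _ _).injective
  ext : 1
  simp [Cocycle.equivHom]

lemma Kb.single_hom_eq_zero {m n : ℤ} (h : m ≠ n) {M N : C}
    (f : (Kb.single C m).obj M ⟶ (Kb.single C n).obj N) : f = 0 := by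
  obtain ⟨φ, hφ, rfl⟩ := Kb.fromSingle_surjective
    (K := (HomologicalComplex.single C (.up ℤ) n).obj N)
    (hK := ((Kb.single C n).obj N).property) f
  refine (Kb.fromSingle_eq_zero_iff φ hφ (m - 1) (by lia)).2 ⟨0, ?_⟩
  exact (HomologicalComplex.isZero_single_obj_X _ _ _ _ h).eq_of_tgt _ _

lemma Kb.single_map_surjective (n : ℤ) {M N : C}
    (f : (Kb.single C n).obj M ⟶ (Kb.single C n).obj N) : ∃ g, (Kb.single C n).map g = f := by
  obtain ⟨g, hg⟩ := (HomotopyCategory.quotient _ _).map_surjective f.hom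
  obtain ⟨g, rfl⟩ := (CochainComplex.singleFunctor C n).map_surjective g
  exact ⟨g, by ext; exact hg⟩

instance (n : ℤ) : (Kb.single C n).Additive where
  map_add := by
    intros
    ext
    exact (CochainComplex.singleFunctor C n ⋙ HomotopyCategory.quotient C (.up ℤ)).map_add

instance {R : Type w} [CommRing R] [Linear R C] (n : ℤ) : (Kb.single C n).Linear R where
  map_smul f r := by
    ext
    exact (CochainComplex.singleFunctor C n ⋙ HomotopyCategory.quotient C (.up ℤ)).map_smul r f

/-- Morphisms from a stalk complex in the top degree. -/
noncomputable def Kb.fromTop (R : Type w) [CommRing R] [Linear R C]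
    (hK : ∃ a b : ℤ, ∀ i : ℤ, i < a ∨ b < i → IsZero (K.X i)) (M : C) (n : ℤ)
    (hn : ∀ i, n < i → IsZero (K.X i)) :
    (M ⟶ K.X n) →ₗ[R] ((Kb.single C n).obj M ⟶ Kb.of K hK) where
  toFun φ := Kb.fromSingle hK φ ((hn _ (lt_add_one n)).eq_of_tgt _ _)
  map_add' φ ψ := by
    ext
    simp only [Kb.fromSingle]
    rw [Cocycle.fromSingleMk_add _ _ _ _ _ ((hn _ (lt_add_one n)).eq_of_tgt _ _)
      ((hn _ (lt_add_one n)).eq_of_tgt _ _)]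
    refine (congrArg _ ((Cocycle.equivHom _ _).symm.map_add _ _)).trans ?_
    exact (HomotopyCategory.quotient C (.up ℤ)).map_add
  map_smul' r φ := by
    ext
    refine Eq.trans ?_ (Functor.map_smul (HomotopyCategory.quotient C (.up ℤ)) r _)
    refine congrArg (HomotopyCategory.quotient C (.up ℤ)).map ?_
    apply (Cocycle.equivHom _ _).injective
    ext : 1
    apply (Cochain.fromSingleEquiv (add_zero n)).injective
    simp [Cocycle.equivHom, Cochain.fromSingleEquiv]
    have h : (HomologicalComplex.singleObjXSelf (.up ℤ) n M).inv ≫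
        (HomologicalComplex.singleObjXSelf (.up ℤ) n M).hom ≫ φ = φ := Iso.inv_hom_id_assoc _ _
    exact (congrArg (r • ·) h).symm.trans (Linear.comp_smul _ _ _ _ _ _).symm

end FromSingle

section ThreeTerm

variable {C : Type u} [Category.{v} C] [Preadditive C] [HasZeroObject C]

open ZeroObject

/-- The terms of the complex `X₀ → X₁ → X₂`. -/
noncomputable def CochainComplex.ofThreeX (X₀ X₁ X₂ : C) : ℤ → C
  | .ofNat 0 => X₀
  | .ofNat 1 => X₁
  | .ofNat 2 => X₂
  | _ => 0

variable {X₀ X₁ X₂ : C} (f : X₀ ⟶ X₁) (g : X₁ ⟶ X₂) (w : f ≫ g = 0)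

/-- The differentials of the complex `X₀ → X₁ → X₂`. -/
noncomputable def CochainComplex.ofThreeD :
    ∀ n : ℤ, ofThreeX X₀ X₁ X₂ n ⟶ ofThreeX X₀ X₁ X₂ (n + 1)
  | .ofNat 0 => f
  | .ofNat 1 => g
  | .ofNat (_ + 2) => 0
  | .negSucc _ => 0

/-- The complex `X₀ → X₁ → X₂` in degrees `0, 1, 2`. -/
noncomputable def CochainComplex.ofThree : CochainComplex C ℤ :=
  CochainComplex.of (ofThreeX X₀ X₁ X₂) (ofThreeD f g)
    fun | .ofNat 0 => w | .ofNat (_ + 1) => comp_zero | .negSucc _ => zero_comp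

lemma CochainComplex.ofThree_d_zero : (ofThree f g w).d 0 1 = f :=
  CochainComplex.of_d (ofThreeX X₀ X₁ X₂) (ofThreeD f g) 0

lemma CochainComplex.ofThree_d_one : (ofThree f g w).d 1 2 = g :=
  CochainComplex.of_d (ofThreeX X₀ X₁ X₂) (ofThreeD f g) 1

lemma CochainComplex.isZero_ofThree (i : ℤ) (h₀ : i ≠ 0) (h₁ : i ≠ 1) (h₂ : i ≠ 2) :
    IsZero ((ofThree f g w).X i) := by
  match i, h₀, h₁, h₂ with
  | .ofNat 0, h, _, _ => exact absurd rfl h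
  | .ofNat 1, _, h, _ => exact absurd rfl h
  | .ofNat 2, _, _, h => exact absurd rfl h
  | .ofNat (_ + 3), _, _, _ => exact isZero_zero C
  | .negSucc _, _, _, _ => exact isZero_zero C

lemma CochainComplex.isBounded_ofThree :
    ∃ a b : ℤ, ∀ i : ℤ, i < a ∨ b < i → IsZero ((CochainComplex.ofThree f g w).X i) :=
  ⟨0, 2, fun i hi => isZero_ofThree f g w i (by lia) (by lia) (by lia)⟩

end ThreeTerm

section SerrePair

variable {R : Type w} [CommRing R] {E : Type w} [AddCommGroup E] [Module R E]
  {C : Type u} [Category.{v} C] [Preadditive C] [Linear R C] [HasZeroObject C]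
  [HasBinaryBiproducts C]

open CochainComplex

/-- The Serre dual of a stalk complex of an object `M` with presentation `P₁ → P₀ → M → 0` is
the complex `K → I₁ → I₀`, where `I₁ → I₀` is dual to `P₁ → P₀`, with kernel `K`. -/
theorem Kb.exists_isSerrePair_single (hE : Module.Baer R E) {P₁ P₀ I₁ I₀ M K : C}
    {t₁ : (P₁ ⟶ I₁) →ₗ[R] E} {t₀ : (P₀ ⟶ I₀) →ₗ[R] E} (h₁ : IsSerrePair t₁)
    (h₀ : IsSerrePair t₀) (d : P₁ ⟶ P₀) (d' : I₁ ⟶ I₀)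
    (hd : ∀ g : P₀ ⟶ I₁, t₀ (g ≫ d') = t₁ (d ≫ g)) (p : P₀ ⟶ M) [Epi p] (hp : d ≫ p = 0)
    (hM : ∀ ⦃Y : C⦄ (x : P₀ ⟶ Y), d ≫ x = 0 → ∃ f, p ≫ f = x) (k : K ⟶ I₁) [Mono k]
    (w : k ≫ d' = 0) (hk : ∀ ⦃Y : C⦄ (x : Y ⟶ I₁), x ≫ d' = 0 → ∃ f, f ≫ k = x) :
    ∃ θ : ((Kb.single C 2).obj M ⟶ Kb.of (ofThree k d' w) (isBounded_ofThree k d' w)) →ₗ[R] E,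
      IsSerrePair θ := by
  have hS : ∀ i, 2 < i → IsZero ((ofThree k d' w).X i) := fun i hi =>
    isZero_ofThree k d' w i (by lia) (by lia) (by lia)
  have hd' : (ofThree k d' w).d 1 2 = d' := ofThree_d_one k d' w
  have hk' : (ofThree k d' w).d 0 1 = k := ofThree_d_zero k d' w
  -- Degree 2 is the top degree, so every `N ⟶ I₀` is a cycle; the boundaries are the morphisms that
  -- factor through `d'`.
  let F (N : C) : (N ⟶ I₀) →ₗ[R] _ := Kb.fromTop R (isBounded_ofThree k d' w) N 2 hS
  have hF (N : C) : Function.Surjective (F N) := fun f => by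
    obtain ⟨φ, _, h⟩ := Kb.fromSingle_surjective f
    exact ⟨φ, h⟩
  have hF₀ (N : C) (a : N ⟶ I₀) : F N a = 0 ↔ ∃ h : N ⟶ I₁, h ≫ d' = a := by
    refine (Kb.fromSingle_eq_zero_iff (K := ofThree k d' w) (M := N) (n := 2) a _ 1 (by norm_num)).trans ?_
    rw [hd']
    rfl
  have key {Y : C} (x : P₀ ⟶ Y) (h : Y ⟶ I₁) : t₀ (x ≫ h ≫ d') = t₁ (d ≫ x ≫ h) := by
    rw [← Category.assoc, hd]
  -- The functional `t₀ (p ≫ -)` descends to homotopy classes: on a boundary `h ≫ d'` it equals `t₁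
  -- (d ≫ p ≫ h) = 0`.
  obtain ⟨θ, hθ⟩ := hE.exists_comp_eq (F M) (t₀ ∘ₗ Linear.leftComp R I₀ p) (by
    intro a ha
    obtain ⟨h, rfl⟩ := (hF₀ M a).1 ha
    rw [LinearMap.comp_apply, Linear.leftComp_apply, key, reassoc_of% hp, zero_comp, map_zero])
  have hθ' {N : C} (f : M ⟶ N) (a : N ⟶ I₀) :
      θ ((Kb.single C 2).map f ≫ F N a) = t₀ (p ≫ f ≫ a) := by
    have : (Kb.single C 2).map f ≫ F N a = F M (f ≫ a) := Kb.single_map_fromSingle f _ _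
    rw [this]
    exact LinearMap.congr_fun hθ (f ≫ a)
  have test (n : ℤ) (N : C) : Function.Bijective (serreMap θ ((Kb.single C n).obj N)) := by
    by_cases hn : n = 2
    · subst hn
      constructor
      · rw [injective_iff_map_eq_zero]
        intro u hu
        obtain ⟨a, rfl⟩ := hF N u
        have ha (f : M ⟶ N) : t₀ (p ≫ f ≫ a) = 0 := by
          rw [← hθ']
          exact LinearMap.congr_fun hu _
        -- The functional `t₀ (- ≫ a)` kills everything that factors through `p`, so it factors
        -- through `d ≫ -`. The resulting functional on `P₁ ⟶ N` is represented by some `h`, and `h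
        -- ≫ d' = a`.
        obtain ⟨χ, hχ⟩ := hE.exists_comp_eq (Linear.leftComp R N d) (serreMap t₀ N a) (by
          intro x hx
          obtain ⟨f, rfl⟩ := hM x hx
          simpa using ha f)
        obtain ⟨h, hh⟩ := h₁.surjective χ
        refine (hF₀ N a).2 ⟨h, h₀.ext fun x => ?_⟩
        rw [key, ← Category.assoc, hh]
        exact LinearMap.congr_fun hχ x
      · intro φ
        obtain ⟨ψ, hψ⟩ := hE.exists_comp_eq (Linear.leftComp R N p)
          (φ ∘ₗ (Kb.single C 2).mapLinearMap R) (by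
            intro f hf
            rw [Linear.leftComp_apply, ← comp_zero (f := p), cancel_epi] at hf
            rw [hf, map_zero])
        obtain ⟨a, ha⟩ := h₀.surjective ψ
        refine ⟨F N a, LinearMap.ext fun f => ?_⟩
        obtain ⟨f, rfl⟩ := Kb.single_map_surjective 2 f
        rw [serreMap_apply, hθ', ← Category.assoc, ha]
        exact LinearMap.congr_fun hψ f
    · constructor
      -- Outside degree 2, both sides vanish: `k` is a kernel of `d'`, so `Hom(N, -)` of the complex
      -- is exact in degrees 0 and 1.
      · have hz (u : (Kb.single C n).obj N ⟶ Kb.of (ofThree k d' w) (isBounded_ofThree k d' w)) :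
            u = 0 := by
          obtain ⟨φ, hφ, rfl⟩ := Kb.fromSingle_surjective u
          refine (Kb.fromSingle_eq_zero_iff φ hφ (n - 1) (by lia)).2 ?_
          by_cases h₀ : n = 0
          · subst h₀
            refine ⟨0, ?_⟩
            rw [zero_comp]
            rw [show (0 : ℤ) + 1 = 1 from rfl, hk'] at hφ
            exact ((cancel_mono k).1 (hφ.trans zero_comp.symm)).symm
          by_cases h₁ : n = 1
          · subst h₁
            rw [show (1 : ℤ) + 1 = 2 from rfl, hd'] at hφ
            obtain ⟨f, hf⟩ := hk φ hφ
            exact ⟨f, (congrArg (f ≫ ·) hk').trans hf⟩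
          exact ⟨0, (isZero_ofThree k d' w n h₀ h₁ hn).eq_of_tgt _ _⟩
        intro u u' _
        rw [hz u, hz u']
      · intro φ
        refine ⟨0, LinearMap.ext fun f => ?_⟩
        rw [Kb.single_hom_eq_zero (Ne.symm hn) f, map_zero, map_zero]
  have := serreTest_isTriangulated hE θ
  have h := Kb.prop_of_single (serreTest θ) fun N n =>
    bijective_serreMap_of_iso (Kb.singleShiftIso N n 0 (-n) (by lia)).symm (test _ N)
  exact ⟨θ, fun Y => bijective_serreMap_of_iso ((shiftFunctorZero _ ℤ).app Y) (h Y 0)⟩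

end SerrePair

/-! ### Serre duals from presentations and copresentations -/

section Duals

open ZeroObject

variable {R : Type w} [CommRing R] {E : Type w} [AddCommGroup E] [Module R E]
  {C : Type u} [Category.{v} C] [Abelian C] [Linear R C]

open CochainComplex

theorem Kb.hasSerreDual_of_epi (hE : Module.Baer R E)
    (hP : ∀ M : C, ∃ (P : C) (p : P ⟶ M), Epi p ∧ hasSerreDual R E C P) (X : Kb C) :
    hasSerreDual R E (Kb C) X := by
  have := hasSerreDual_isTriangulated (R := R) (T := Kb C) hE
  refine Kb.prop_of_single _ (fun M => Kb.prop_single _ M 2 0 ?_) X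
  obtain ⟨P₀, p, _, I₀, t₀, h₀⟩ := hP M
  obtain ⟨P₁, q, _, I₁, t₁, h₁⟩ := hP (kernel p)
  obtain ⟨d', hd'⟩ := h₀.surjective (t₁ ∘ₗ Linear.leftComp R I₁ (q ≫ kernel.ι p))
  obtain ⟨θ, hθ⟩ := Kb.exists_isSerrePair_single hE h₁ h₀ (q ≫ kernel.ι p) d' hd' p (by simp)
    (fun Y x hx => by
      rw [Category.assoc, ← comp_zero (f := q), cancel_epi] at hx
      exact ⟨_, (CokernelCofork.IsColimit.desc'
        (Abelian.epiIsCokernelOfKernel _ (kernelIsKernel p)) x hx).2⟩)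
    (kernel.ι d') (kernel.condition d') (fun Y x hx => ⟨kernel.lift _ x hx, kernel.lift_ι _ _ _⟩)
  exact ⟨_, θ, hθ⟩

/-- The presentation `0 → P → P` has as its dual the complex `0 → 0 → I`, in which dévissage
isolates `I`. -/
theorem Kb.isSerreDual_single (hE : Module.Baer R E) {I : C} (hI : isSerreDual R E C I) (n : ℤ)
    [(isSerreDual R E (Kb C)).IsTriangulated] :
    isSerreDual R E (Kb C) ((Kb.single C n).obj I) := by
  obtain ⟨P, t, h⟩ := hI
  have h₀ : IsSerrePair (0 : ((0 : C) ⟶ (0 : C)) →ₗ[R] E) :=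
    isSerrePair_of_isZero (isZero_zero C) (isZero_zero C)
  have w : (0 : (0 : C) ⟶ 0) ≫ (0 : (0 : C) ⟶ I) = 0 := zero_comp
  have : Mono (0 : (0 : C) ⟶ 0) := ⟨fun _ _ _ => (isZero_zero C).eq_of_tgt _ _⟩
  obtain ⟨θ, hθ⟩ := Kb.exists_isSerrePair_single hE h₀ h 0 (0 : (0 : C) ⟶ I) (by simp) (𝟙 P)
    zero_comp (fun Y x _ => ⟨x, Category.id_comp x⟩) 0 w
    (fun Y x _ => ⟨0, (isZero_zero C).eq_of_tgt _ _⟩)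
  refine Kb.prop_single _ I 2 n ((Kb.devissage (isSerreDual R E (Kb C)) (ofThree _ _ w)
    (isBounded_ofThree _ _ w) 2 fun n hn => Kb.prop_single_zero _ ?_ n).1 ⟨_, θ, hθ⟩)
  by_cases h₀ : n = 0
  · subst h₀
    exact isZero_zero C
  by_cases h₁ : n = 1
  · subst h₁
    exact isZero_zero C
  exact isZero_ofThree _ _ _ n h₀ h₁ hn

/-- A copresentation `N → I₁ → I₀` is dual to some `d : P₁ ⟶ P₀`, so this complex is the Serre dual
of `cokernel d`. Its terms `I₁` and `I₀` are Serre duals already, and dévissage leaves `N`. -/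
theorem Kb.isSerreDual_of_mono (hE : IsMatlisDualizing.{w, v, w} R E)
    (hC : IsHomFinite R C) (hK : IsHomFinite R (Kb C))
    (hI : ∀ N : C, ∃ (I : C) (i : N ⟶ I), Mono i ∧ isSerreDual R E C I) (X : Kb C) :
    isSerreDual R E (Kb C) X := by
  have := isSerreDual_isTriangulated (R := R) (T := Kb C) hE hK
  refine Kb.prop_of_single _ (fun N => ?_) X
  obtain ⟨I₁, i, _, hI₁⟩ := hI N
  obtain ⟨I₀, j, _, hI₀⟩ := hI (cokernel i)
  have hI₁' := Kb.isSerreDual_single hE.baer hI₁ 1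
  have hI₀' := Kb.isSerreDual_single hE.baer hI₀ 2
  obtain ⟨P₁, t₁, h₁⟩ := hI₁
  obtain ⟨P₀, t₀, h₀⟩ := hI₀
  obtain ⟨d, hd⟩ := (h₁.bijective_left hE hC P₀).2 (t₀ ∘ₗ Linear.rightComp R P₀ (cokernel.π i ≫ j))
  have w : i ≫ cokernel.π i ≫ j = 0 := by simp
  obtain ⟨θ, hθ⟩ := Kb.exists_isSerrePair_single hE.baer h₁ h₀ d (cokernel.π i ≫ j)
    (fun g => (LinearMap.congr_fun hd g).symm) (cokernel.π d) (cokernel.condition d)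
    (fun Y x hx => ⟨cokernel.desc _ x hx, cokernel.π_desc _ _ _⟩) i w (fun Y x hx => by
      rw [← Category.assoc, ← zero_comp (f := j), cancel_mono] at hx
      exact ⟨_, (KernelFork.IsLimit.lift'
        (Abelian.monoIsKernelOfCokernel _ (cokernelIsCokernel i)) x hx).2⟩)
  refine (Kb.devissage (isSerreDual R E (Kb C)) (ofThree i (cokernel.π i ≫ j) w)
    (isBounded_ofThree _ _ w) 0 fun n hn => ?_).1 ⟨_, θ, hθ⟩
  by_cases h₁ : n = 1
  · subst h₁
    exact hI₁'
  by_cases h₂ : n = 2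
  · subst h₂
    exact hI₀'
  exact Kb.prop_single_zero _ (isZero_ofThree _ _ _ n hn h₁ h₂) n

end Duals

/-! ### Semiorthogonal decompositions -/

section Semiorthogonal

open Pretriangulated

variable {T : Type u} [Category.{v} T] [Preadditive T] [HasShift T ℤ]
  [∀ n : ℤ, (shiftFunctor T n).Additive] [HasZeroObject T] [Pretriangulated T]

variable {A B : ObjectProperty T} [A.IsTriangulated] [B.IsTriangulated]

/-- The connecting morphism goes from `A` to a shift of an object of `B`, so it vanishes and the
triangle splits; the summands can then be exchanged. -/
lemma extensionProduct_swap_le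
    (h : ∀ ⦃X Y : T⦄ (f : X ⟶ Y), A X → B Y → f = 0) :
    B.extensionProduct A ≤ A.extensionProduct B := by
  rintro X ⟨Y, Z, f, g, k, hT, hY, hZ⟩
  have hk : k = 0 := h k hZ (B.le_shift (1 : ℤ) _ hY)
  obtain ⟨e, -⟩ := exists_iso_binaryBiproduct_of_distTriang _ hT hk
  exact (A.extensionProduct B).prop_of_iso ((biprod.braiding _ _).trans e.symm)
    ⟨Z, Y, _, _, _, binaryBiproductTriangle_distinguished Z Y, hZ, hY⟩

/-- For extension products, `(A * B) * (A * B) = A * (B * A) * B ≤ A * (A * B) * B = (A * A) * (B *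
B) ≤ A * B`. -/
theorem extensionProduct_isTriangulated [IsTriangulated T] [A.IsClosedUnderIsomorphisms]
    [B.IsClosedUnderIsomorphisms] (h : ∀ ⦃X Y : T⦄ (f : X ⟶ Y), A X → B Y → f = 0) :
    (A.extensionProduct B).IsTriangulated where
  exists_zero := ⟨_, isZero_zero T, ObjectProperty.le_extensionProduct_left _ _
    (A.prop_of_iso (A.exists_prop_of_containsZero.choose_spec.1.iso (isZero_zero T))
      A.exists_prop_of_containsZero.choose_spec.2)⟩
  toIsTriangulatedClosed₂ := .mk' fun S hS h₁ h₃ => by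
    have hA : A.extensionProduct A ≤ A :=
      ObjectProperty.extensionProduct_le_of_isTriangulatedClosed₂ le_rfl le_rfl
    have hB : B.extensionProduct B ≤ B :=
      ObjectProperty.extensionProduct_le_of_isTriangulatedClosed₂ le_rfl le_rfl
    have hQ : (A.extensionProduct B).extensionProduct (A.extensionProduct B) ≤
        A.extensionProduct B := by
      rw [ObjectProperty.extensionProduct_assoc, ← ObjectProperty.extensionProduct_assoc B A B]
      refine (ObjectProperty.monotone_extensionProduct_right _
        (ObjectProperty.monotone_extensionProduct_left _ (extensionProduct_swap_le h))).trans ?_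
      rw [ObjectProperty.extensionProduct_assoc A B B, ← ObjectProperty.extensionProduct_assoc A A]
      exact (ObjectProperty.monotone_extensionProduct_left _ hA).trans
        (ObjectProperty.monotone_extensionProduct_right _ hB)
    exact hQ _ ⟨_, _, _, _, _, hS, h₁, h₃⟩

lemma exists_coreflection
    (h : ∀ ⦃X Y : T⦄ (f : X ⟶ Y), A X → B Y → f = 0) {X : T}
    (hX : A.extensionProduct B X) :
    ∃ (Y : T) (f : Y ⟶ X), A Y ∧ ∀ ⦃W : T⦄, A W → Function.Bijective fun a : W ⟶ Y => a ≫ f := by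
  obtain ⟨Y, Z, f, g, k, hT, hY, hZ⟩ := hX
  refine ⟨Y, f, hY, fun W hW => ⟨fun a a' haa => ?_, fun b => ?_⟩⟩
  · rw [← sub_eq_zero]
    have : (a - a') ≫ f = 0 := by rw [Preadditive.sub_comp, sub_eq_zero]; exact haa
    obtain ⟨c, hc⟩ := Triangle.coyoneda_exact₂ _ (inv_rot_of_distTriang _ hT) (a - a') this
    rw [hc, h c hW (B.le_shift (-1 : ℤ) _ hZ), zero_comp]
    rfl
  · obtain ⟨a, ha⟩ := Triangle.coyoneda_exact₂ _ hT b (h _ hW hZ)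
    exact ⟨a, ha.symm⟩

lemma exists_reflection
    (h : ∀ ⦃X Y : T⦄ (f : X ⟶ Y), A X → B Y → f = 0) {X : T}
    (hX : A.extensionProduct B X) :
    ∃ (Z : T) (g : X ⟶ Z), B Z ∧ ∀ ⦃W : T⦄, B W → Function.Bijective fun a : Z ⟶ W => g ≫ a := by
  obtain ⟨Y, Z, f, g, k, hT, hY, hZ⟩ := hX
  refine ⟨Z, g, hZ, fun W hW => ⟨fun a a' haa => ?_, fun b => ?_⟩⟩
  · rw [← sub_eq_zero]
    have : g ≫ (a - a') = 0 := by rw [Preadditive.comp_sub, sub_eq_zero]; exact haa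
    obtain ⟨c, hc⟩ := Triangle.yoneda_exact₃ _ hT (a - a') this
    rw [hc, h c (A.le_shift (1 : ℤ) _ hY) hW, comp_zero]
    rfl
  · obtain ⟨a, ha⟩ := Triangle.yoneda_exact₂ _ hT b (h _ hY hW)
    exact ⟨a, ha.symm⟩

end Semiorthogonal

lemma isLeftAdjoint_ι_of_exists_coreflection {T : Type u} [Category.{v} T] (A : ObjectProperty T)
    (h : ∀ X : T, ∃ (Y : T) (f : Y ⟶ X), A Y ∧
      ∀ ⦃W : T⦄, A W → Function.Bijective fun a : W ⟶ Y => a ≫ f) : A.ι.IsLeftAdjoint := by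
  rw [isLeftAdjoint_iff_hasTerminal_costructuredArrow]
  intro X
  obtain ⟨Y, f, hY, hf⟩ := h X
  let t : CostructuredArrow A.ι X := CostructuredArrow.mk (Y := (⟨Y, hY⟩ : A.FullSubcategory)) f
  refine IsTerminal.hasTerminal (X := t) (IsTerminal.ofUniqueHom (fun W => ?_) fun W m => ?_)
  · exact CostructuredArrow.homMk (ObjectProperty.homMk ((hf W.left.property).2 W.hom).choose)
      ((hf W.left.property).2 W.hom).choose_spec
  · ext
    apply (hf W.left.property).1
    exact (CostructuredArrow.w m).trans ((hf W.left.property).2 W.hom).choose_spec.symm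

/-! ### Acyclic complexes and their orthogonals -/

section Acyclic

variable {C : Type u} [Category.{v} C] [Abelian C]

lemma isAcyclicComplex_eq : isAcyclicComplex C =
    (HomotopyCategory.subcategoryAcyclic C).inverseImage (isBoundedComplex C).ι := by
  ext X
  exact (HomotopyCategory.quotient_obj_mem_subcategoryAcyclic_iff_exactAt X.obj.as).symm

instance : (isAcyclicComplex C).IsTriangulated := by
  rw [isAcyclicComplex_eq]
  infer_instance

instance : (isAcyclicComplex C).IsClosedUnderIsomorphisms := by
  rw [isAcyclicComplex_eq]
  infer_instance

lemma Kb.rightOrthogonal_single (I : C) [Injective I] (n : ℤ) :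
    (isAcyclicComplex C).rightOrthogonal ((Kb.single C n).obj I) := by
  intro X f hX
  have : ((CochainComplex.singleFunctor C n).obj I).IsKInjective := by
    have h (i : ℤ) : Injective (((CochainComplex.singleFunctor C n).obj I).X i) := by
      by_cases h : i = n
      · subst h
        exact Injective.of_iso (HomologicalComplex.singleObjXSelf (.up ℤ) i I).symm inferInstance
      · exact (HomologicalComplex.isZero_single_obj_X _ _ _ _ h).injective
    have : ((CochainComplex.singleFunctor C n).obj I).IsStrictlyGE n :=
      (CochainComplex.isStrictlyGE_iff _ _).2 fun i hi =>
        HomologicalComplex.isZero_single_obj_X _ _ _ _ (by lia)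
    exact CochainComplex.isKInjective_of_injective _ n
  rw [isAcyclicComplex_eq] at hX
  ext
  exact CochainComplex.IsKInjective.rightOrthogonal _ f.hom hX

lemma Kb.leftOrthogonal_single (P : C) [Projective P] (n : ℤ) :
    (isAcyclicComplex C).leftOrthogonal ((Kb.single C n).obj P) := by
  intro X f hX
  have : ((CochainComplex.singleFunctor C n).obj P).IsKProjective := by
    have h (i : ℤ) : Projective (((CochainComplex.singleFunctor C n).obj P).X i) := by
      by_cases h : i = n
      · subst h
        exact Projective.of_iso (HomologicalComplex.singleObjXSelf (.up ℤ) i P).symm inferInstance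
      · exact (HomologicalComplex.isZero_single_obj_X _ _ _ _ h).projective
    have : ((CochainComplex.singleFunctor C n).obj P).IsStrictlyLE n :=
      (CochainComplex.isStrictlyLE_iff _ _).2 fun i hi =>
        HomologicalComplex.isZero_single_obj_X _ _ _ _ (by lia)
    exact CochainComplex.isKProjective_of_projective _ n
  rw [isAcyclicComplex_eq] at hX
  ext
  exact CochainComplex.IsKProjective.leftOrthogonal _ f.hom hX

open CochainComplex

lemma Kb.isAcyclicComplex_ofThree (S : ShortComplex C) (hS : S.ShortExact) :
    isAcyclicComplex C (Kb.of (ofThree S.f S.g S.zero) (isBounded_ofThree _ _ _)) := by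
  intro i
  change (ofThree S.f S.g S.zero).ExactAt i
  have h₀ := ofThree_d_zero S.f S.g S.zero
  have h₁ := ofThree_d_one S.f S.g S.zero
  have := hS.mono_f
  have := hS.epi_g
  by_cases hi₀ : i = 0
  · subst hi₀
    rw [HomologicalComplex.exactAt_iff' _ (-1) 0 1 (by simp) (by simp)]
    refine (ShortComplex.exact_iff_mono _ ?_).2 ?_
    · exact (isZero_ofThree S.f S.g S.zero (-1) (by lia) (by lia) (by lia)).eq_of_src _ _
    · change Mono ((ofThree S.f S.g S.zero).d 0 1)
      rw [h₀]
      exact hS.mono_f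
  by_cases hi₁ : i = 1
  · subst hi₁
    rw [HomologicalComplex.exactAt_iff' _ 0 1 2 (by simp) (by simp)]
    refine ShortComplex.exact_of_iso (ShortComplex.isoMk (Iso.refl S.X₁) (Iso.refl S.X₂)
      (Iso.refl S.X₃) ?_ ?_) hS.exact
    · refine (Category.id_comp _).trans (h₀.trans (Category.comp_id _).symm)
    · refine (Category.id_comp _).trans (h₁.trans (Category.comp_id _).symm)
  by_cases hi₂ : i = 2
  · subst hi₂
    rw [HomologicalComplex.exactAt_iff' _ 1 2 3 (by simp) (by simp)]
    refine (ShortComplex.exact_iff_epi _ ?_).2 ?_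
    · exact (isZero_ofThree S.f S.g S.zero 3 (by lia) (by lia) (by lia)).eq_of_tgt _ _
    · change Epi ((ofThree S.f S.g S.zero).d 1 2)
      rw [h₁]
      exact hS.epi_g
  exact ShortComplex.exact_of_isZero_X₂ _ (isZero_ofThree S.f S.g S.zero i hi₀ hi₁ hi₂)

variable (Q : ObjectProperty (Kb C)) [Q.IsTriangulated] [Q.IsClosedUnderIsomorphisms]

/-- A short exact sequence is itself an acyclic complex, so it lies in `Q`; dévissage with
exceptional degree 0 isolates `S.X₁`. -/
lemma Kb.prop_X₁_of_shortExact {S : ShortComplex C} (hS : S.ShortExact)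
    (hQ : isAcyclicComplex C ≤ Q) (h₂ : Q ((Kb.single C 0).obj S.X₂))
    (h₃ : Q ((Kb.single C 0).obj S.X₃)) : Q ((Kb.single C 0).obj S.X₁) := by
  refine (Kb.devissage Q (ofThree S.f S.g S.zero) (isBounded_ofThree _ _ _) 0 fun n hn => ?_).1
    (hQ _ (Kb.isAcyclicComplex_ofThree S hS))
  by_cases h1 : n = 1
  · subst h1
    exact Kb.prop_single Q _ _ _ h₂
  by_cases h2 : n = 2
  · subst h2
    exact Kb.prop_single Q _ _ _ h₃
  exact Kb.prop_single_zero _ (isZero_ofThree _ _ _ n hn h1 h2) n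

lemma Kb.prop_X₃_of_shortExact {S : ShortComplex C} (hS : S.ShortExact)
    (hQ : isAcyclicComplex C ≤ Q) (h₁ : Q ((Kb.single C 0).obj S.X₁))
    (h₂ : Q ((Kb.single C 0).obj S.X₂)) : Q ((Kb.single C 0).obj S.X₃) := by
  refine Kb.prop_single Q _ 2 0 <|
    (Kb.devissage Q (ofThree S.f S.g S.zero) (isBounded_ofThree _ _ _) 2 fun n hn => ?_).1
    (hQ _ (Kb.isAcyclicComplex_ofThree S hS))
  by_cases h0 : n = 0
  · subst h0
    exact h₁
  by_cases h1 : n = 1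
  · subst h1
    exact Kb.prop_single Q _ _ _ h₂
  exact Kb.prop_single_zero _ (isZero_ofThree _ _ _ n h0 h1 hn) n

/-- Induction on injective dimension through cosyzygies. Dimension `< 0` means zero and `< 1` means
injective, so the inductive step begins at `n + 2`. -/
theorem Kb.prop_of_injective [EnoughInjectives C]
    (hC : ∀ M : C, ∃ n, HasInjectiveDimensionLT M n) (hQ : isAcyclicComplex C ≤ Q)
    (hI : ∀ I : C, Injective I → Q ((Kb.single C 0).obj I)) (X : Kb C) : Q X := by
  refine Kb.prop_of_single Q (fun M => ?_) X
  obtain ⟨n, hn⟩ := hC M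
  induction n generalizing M with
  | zero => exact Kb.prop_single_zero Q (isZero_of_hasInjectiveDimensionLT_zero M) 0
  | succ n ih =>
    cases n with
    | zero => exact hI M (injective_iff_hasInjectiveDimensionLT_one.2 hn)
    | succ n =>
      have hS : (ShortComplex.mk (Injective.ι M) (cokernel.π (Injective.ι M)) (by simp)).ShortExact :=
        { exact := ShortComplex.exact_cokernel _ }
      exact Kb.prop_X₁_of_shortExact Q hS hQ (hI _ inferInstance)
        (ih _ ((hS.hasInjectiveDimensionLT_X₃_iff n inferInstance).2 hn))

theorem Kb.prop_of_projective [EnoughProjectives C]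
    (hC : ∀ M : C, ∃ n, HasProjectiveDimensionLT M n) (hQ : isAcyclicComplex C ≤ Q)
    (hP : ∀ P : C, Projective P → Q ((Kb.single C 0).obj P)) (X : Kb C) : Q X := by
  refine Kb.prop_of_single Q (fun M => ?_) X
  obtain ⟨n, hn⟩ := hC M
  induction n generalizing M with
  | zero => exact Kb.prop_single_zero Q (isZero_of_hasProjectiveDimensionLT_zero M) 0
  | succ n ih =>
    cases n with
    | zero => exact hP M (projective_iff_hasProjectiveDimensionLT_one.2 hn)
    | succ n =>
      have hS : (ShortComplex.mk (kernel.ι (Projective.π M)) (Projective.π M) (by simp)).ShortExact :=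
        { exact := ShortComplex.exact_kernel _ }
      exact Kb.prop_X₃_of_shortExact Q hS hQ
        (ih _ ((hS.hasProjectiveDimensionLT_X₃_iff n inferInstance).1 hn)) (hP _ inferInstance)

variable (C) in
-- Acyclic complexes and their right orthogonal form a semiorthogonal decomposition: their extension
-- product contains all acyclic complexes and all injective stalks.
theorem Kb.exists_coreflection_acyclic [EnoughInjectives C]
    (hC : ∀ M : C, ∃ n, HasInjectiveDimensionLT M n) (X : Kb C) :
    ∃ (Y : Kb C) (f : Y ⟶ X), isAcyclicComplex C Y ∧
      ∀ ⦃W : Kb C⦄, isAcyclicComplex C W → Function.Bijective fun a : W ⟶ Y => a ≫ f := by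
  have h : ∀ ⦃X Y : Kb C⦄ (f : X ⟶ Y), isAcyclicComplex C X →
    (isAcyclicComplex C).rightOrthogonal Y → f = 0 := fun X Y f hX hY => hY f hX
  have := extensionProduct_isTriangulated h
  exact exists_coreflection h (Kb.prop_of_injective _ hC
    (ObjectProperty.le_extensionProduct_left _)
    (fun I _ => ObjectProperty.le_extensionProduct_right _ _ (Kb.rightOrthogonal_single I 0)) X)

variable (C) in
theorem Kb.exists_reflection_acyclic [EnoughProjectives C]
    (hC : ∀ M : C, ∃ n, HasProjectiveDimensionLT M n) (X : Kb C) :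
    ∃ (Y : Kb C) (f : X ⟶ Y), isAcyclicComplex C Y ∧
      ∀ ⦃W : Kb C⦄, isAcyclicComplex C W → Function.Bijective fun a : Y ⟶ W => f ≫ a := by
  have h : ∀ ⦃X Y : Kb C⦄ (f : X ⟶ Y), (isAcyclicComplex C).leftOrthogonal X →
    isAcyclicComplex C Y → f = 0 := fun X Y f hX hY => hX f hY
  have := extensionProduct_isTriangulated h
  exact exists_reflection h (Kb.prop_of_projective _ hC
    (ObjectProperty.le_extensionProduct_right _)
    (fun P _ => ObjectProperty.le_extensionProduct_left _ _ (Kb.leftOrthogonal_single P 0)) X)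

end Acyclic

/-! ### Serre functors on coreflective and reflective subcategories -/

section

variable {R : Type w} [CommRing R] {E : Type w} [AddCommGroup E] [Module R E]
  {T : Type u} [Category.{v} T] [Preadditive T] [Linear R T]

/-- The morphisms in a full subcategory are the morphisms in the ambient category. -/
def fullSubcategoryHomEquiv (R : Type w) [CommRing R] [Linear R T] {A : ObjectProperty T}
    (X Y : A.FullSubcategory) : (X ⟶ Y) ≃ₗ[R] (X.obj ⟶ Y.obj) where
  toFun f := f.hom
  map_add' _ _ := rfl
  map_smul' _ _ := rfl
  invFun f := ObjectProperty.homMk f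

lemma IsHomFinite.fullSubcategory (hT : IsHomFinite R T) (A : ObjectProperty T) :
    IsHomFinite R A.FullSubcategory := fun X Y =>
  have := hT X.obj Y.obj
  Module.Finite.equiv (fullSubcategoryHomEquiv R X Y).symm

/-- The adjunction gives `Hom(Y, r U X) ≅ Hom(Y, U X) ≅ D Hom(X, Y)` for `X`, `Y` in `A`. The
reflections `hA` serve to exhibit each object of `A` as a Serre dual inside `A`. -/
theorem isSerreFunctor_of_coreflective (hE : IsMatlisDualizing.{w, v, w} R E)
    (hT : IsHomFinite R T) (A : ObjectProperty T) {U : T ⥤ T} (hU : IsSerreFunctor R E U)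
    (hl : ∀ Y : T, isSerreDual R E T Y) {r : T ⥤ A.FullSubcategory} (adj : A.ι ⊣ r)
    (hA : ∀ X : T, ∃ (Z : T) (f : X ⟶ Z), A Z ∧
      ∀ ⦃W : T⦄, A W → Function.Bijective fun a : Z ⟶ W => f ≫ a) :
    IsSerreFunctor R E (A.ι ⋙ U ⋙ r) := by
  obtain ⟨θ, hθ, nat⟩ := hU.exists_isSerrePair
  let θ' (X : A.FullSubcategory) : (X ⟶ (A.ι ⋙ U ⋙ r).obj X) →ₗ[R] E :=
    θ X.obj ∘ₗ Linear.rightComp R X.obj (adj.counit.app (U.obj X.obj)) ∘ₗ A.ι.mapLinearMap R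
  have hθ' (X Y : A.FullSubcategory) (f : X ⟶ Y) (g : Y ⟶ r.obj (U.obj X.obj)) :
      θ' X (f ≫ g) = θ X.obj (f.hom ≫ (adj.homEquiv Y (U.obj X.obj)).symm g) := by
    rw [adj.homEquiv_counit]
    exact congrArg _ (Category.assoc _ _ _)
  refine isSerreFunctor_of_isSerrePair hE (hT.fullSubcategory A) _ θ' ?_ ?_ ?_
  · intro X Y
    constructor
    · intro g g' hg
      apply (adj.homEquiv Y (U.obj X.obj)).symm.injective
      apply (hθ X.obj).ext
      intro f
      have := LinearMap.congr_fun hg (ObjectProperty.homMk f : X ⟶ Y)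
      rw [serreMap_apply, serreMap_apply, hθ', hθ'] at this
      exact this
    · intro φ
      obtain ⟨g, hg⟩ := (hθ X.obj).surjective (Y := Y.obj)
        (φ ∘ₗ (fullSubcategoryHomEquiv R X Y).symm.toLinearMap)
      refine ⟨adj.homEquiv Y (U.obj X.obj) g, LinearMap.ext fun f => ?_⟩
      rw [serreMap_apply, hθ', Equiv.symm_apply_apply]
      exact hg f.hom
  · intro X X' f g
    rw [hθ' X X' f g, ← nat]
    have : θ' X' (g ≫ (A.ι ⋙ U ⋙ r).map f) = θ X'.obj ((adj.homEquiv X' (U.obj X'.obj)).symm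
        (g ≫ r.map (U.map f.hom))) := by
      rw [adj.homEquiv_counit]
      rfl
    rw [this, adj.homEquiv_naturality_right_symm]
    rfl
  -- If `Y` represents `D T(V, -)` and `Z` is the reflection of `V`, then `T(V, W) ≅ T(Z, W)` for
  -- `W` in `A`, so `Y` represents `D T(Z, -)` on `A`.
  · intro Y
    obtain ⟨V, t, ht⟩ := hl Y.obj
    obtain ⟨Z, η, hZ, hη⟩ := hA V
    let t' : ((⟨Z, hZ⟩ : A.FullSubcategory) ⟶ Y) →ₗ[R] E :=
      t ∘ₗ Linear.leftComp R Y.obj η ∘ₗ A.ι.mapLinearMap R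
    have ht' (W : A.FullSubcategory) (a : (⟨Z, hZ⟩ : A.FullSubcategory) ⟶ W) (b : W ⟶ Y) :
        t' (a ≫ b) = t ((η ≫ a.hom) ≫ b.hom) := congrArg t (Category.assoc _ _ _).symm
    refine ⟨⟨Z, hZ⟩, t', fun W => ⟨fun b b' hb => ?_, fun φ => ?_⟩⟩
    · ext
      refine ht.ext fun f => ?_
      obtain ⟨a, rfl⟩ := (hη W.property).2 f
      have := LinearMap.congr_fun hb (ObjectProperty.homMk a : (⟨Z, hZ⟩ : A.FullSubcategory) ⟶ W)
      rw [serreMap_apply, serreMap_apply, ht', ht'] at this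
      exact this
    · let e := LinearEquiv.ofBijective (Linear.leftComp R W.obj η) (hη W.property)
      obtain ⟨b, hb⟩ := ht.surjective ((φ ∘ₗ
        (fullSubcategoryHomEquiv R (⟨Z, hZ⟩ : A.FullSubcategory) W).symm.toLinearMap) ∘ₗ
          e.symm.toLinearMap)
      refine ⟨ObjectProperty.homMk b, LinearMap.ext fun f => ?_⟩
      rw [serreMap_apply, ht']
      refine (hb _).trans ?_
      have : e.symm (η ≫ f.hom) = f.hom := e.symm_apply_apply f.hom
      rw [LinearMap.comp_apply, LinearEquiv.coe_coe, this]
      rfl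

end

/-! ### Injectivity and projectivity from Serre pairs -/

section Abelian

variable {R : Type w} [CommRing R] {E : Type w} [AddCommGroup E] [Module R E]
  {C : Type u} [Category.{v} C] [Abelian C] [Linear R C]

/-- `Hom(-, I) ≅ D Hom(P, -)`, which turns monomorphisms into surjections because `E` is injective.
-/
lemma injective_of_isSerreDual (hE : Module.Baer R E) {I : C} (hI : isSerreDual R E C I) :
    Injective I where
  factors {X Y} g f _ := by
    obtain ⟨P, t, ht⟩ := hI
    obtain ⟨χ, hχ⟩ := hE.exists_comp_eq (Linear.rightComp R P f) (serreMap t X g) (by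
      intro x hx
      rw [Linear.rightComp_apply, ← zero_comp (f := f), cancel_mono] at hx
      rw [hx, map_zero])
    obtain ⟨h, hh⟩ := ht.surjective χ
    refine ⟨h, ht.ext fun x => ?_⟩
    rw [← Category.assoc, hh]
    exact LinearMap.congr_fun hχ x

/-- A functional on the cokernel of `Hom(P, Y) → Hom(P, X)` is represented by some `a` with `f ≫ a =
0`, so it vanishes; functionals separate points, hence the cokernel is zero. -/
lemma projective_of_hasSerreDual (hE : IsMatlisDualizing.{w, v, w} R E) (hC : IsHomFinite R C)
    {P : C} (hP : hasSerreDual R E C P) : Projective P where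
  factors {Y X} g f _ := by
    obtain ⟨I, t, ht⟩ := hP
    have := hC P Y
    let N := LinearMap.range (Linear.rightComp R P f)
    have h : N = ⊤ := by
      have := hC P X
      by_contra hN
      obtain ⟨x, hx⟩ : ∃ x, x ∉ N := by
        by_contra! hN'
        exact hN (eq_top_iff.2 fun x _ => hN' x)
      have hx' : N.mkQ x ≠ 0 := by simpa using hx
      refine hx' ((hE.bijective_dualEval _ inferInstance).1 (LinearMap.ext fun φ => ?_))
      obtain ⟨a, ha⟩ := ht.surjective (φ ∘ₗ N.mkQ)
      have hfa : f ≫ a = 0 := ht.ext fun y => by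
        rw [← Category.assoc, ha, comp_zero, map_zero, LinearMap.comp_apply]
        have : N.mkQ (y ≫ f) = 0 := by simpa using ⟨y, rfl⟩
        rw [this, map_zero]
      have ha0 : a = 0 := by rwa [← comp_zero (f := f), cancel_epi] at hfa
      have := ha x
      rw [ha0, comp_zero, map_zero] at this
      simpa using this.symm
    have hg : g ∈ N := h ▸ Submodule.mem_top
    exact hg

end Abelian

/-! ### Krull-Schmidt categories -/

section Fitting

variable {A B : Type*} [Ring A] [Ring B]

/-- The subalgebra `R[a]` is commutative and artinian, so the ideals generated by the powers of `a`
stabilize. -/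
lemma exists_commute_pow_mul_eq (R : Type*) [CommRing R] [IsArtinianRing R] [Algebra R A]
    [Module.Finite R A] (a : A) :
    ∃ (n : ℕ) (y : A), 0 < n ∧ Commute a y ∧ a ^ n * (a * y) = a ^ n := by
  let S := Algebra.adjoin R {a}
  have : IsMulCommutative S := Algebra.isMulCommutative_adjoin R (by simp)
  let _ : CommRing S := { mul_comm := mul_comm' }
  have : IsNoetherian R A := inferInstance
  have : Module.Finite R S := Module.Finite.of_injective S.val.toLinearMap Subtype.val_injective
  have : IsArtinianRing S := IsArtinianRing.of_finite R S
  obtain ⟨n, y, hy⟩ := IsArtinian.exists_pow_succ_smul_dvd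
    (⟨a, Algebra.self_mem_adjoin_singleton R a⟩ : S) (1 : S)
  have hy' : a ^ (n + 1) * y = a ^ n := by simpa using congrArg Subtype.val hy
  refine ⟨n + 1, y, n.succ_pos, ?_, ?_⟩
  · exact congrArg Subtype.val (mul_comm (⟨a, Algebra.self_mem_adjoin_singleton R a⟩ : S) y)
  · have hc : Commute a y :=
      congrArg Subtype.val (mul_comm (⟨a, Algebra.self_mem_adjoin_singleton R a⟩ : S) y)
    rw [hc.eq, ← mul_assoc, hy', pow_succ]

/-- Some power of an element of a finite algebra is, up to a unit, an idempotent. -/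
lemma exists_isIdempotentElem_fitting (R : Type*) [CommRing R] [IsArtinianRing R] [Algebra R A]
    [Module.Finite R A] (a : A) :
    ∃ (n : ℕ) (y : A), 0 < n ∧ Commute a y ∧ IsIdempotentElem (a ^ n * y ^ n) ∧
      a ^ n * (a ^ n * y ^ n) = a ^ n := by
  obtain ⟨n, y, hn, hc, h⟩ := exists_commute_pow_mul_eq R a
  have key (k : ℕ) : a ^ n * (a ^ k * y ^ k) = a ^ n := by
    rw [← hc.mul_pow]
    induction k with
    | zero => simp
    | succ k ih => rw [pow_succ, ← mul_assoc, ih, h]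
  refine ⟨n, y, hn, hc, ?_, key n⟩
  have hc' : Commute (a ^ n) (y ^ n) := hc.pow_pow n n
  rw [IsIdempotentElem, hc'.eq, mul_assoc, ← hc'.eq, key n]
  exact hc'.eq.symm

/-- Idempotents lift along surjective homomorphisms from finite algebras. -/
lemma exists_isIdempotentElem_lift (R : Type*) [CommRing R] [IsArtinianRing R] [Algebra R A]
    [Module.Finite R A] (φ : A →+* B) (hφ : Function.Surjective φ) {e : B}
    (he : IsIdempotentElem e) : ∃ e' : A, IsIdempotentElem e' ∧ φ e' = e := by
  obtain ⟨f, rfl⟩ := hφ e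
  obtain ⟨n, y, hn, hc, hi, h⟩ := exists_isIdempotentElem_fitting R f
  refine ⟨_, hi, ?_⟩
  have hp : φ f ^ n = φ f := by
    obtain ⟨m, rfl⟩ := Nat.exists_eq_succ_of_ne_zero hn.ne'
    exact he.pow_succ_eq m
  have h' := congrArg φ h
  simp only [map_mul, map_pow, hp] at h' ⊢
  rw [← mul_assoc, he.eq] at h'
  exact h'

/-- If the Fitting idempotent of `a` is 0, then `a` is nilpotent and `1 - a` is a unit; if it is 1,
then `a` is a unit. -/
lemma isLocalRing_of_isIdempotentElem (R : Type*) [CommRing R] [IsArtinianRing R] [Algebra R A]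
    [Module.Finite R A] [Nontrivial A]
    (h : ∀ e : A, IsIdempotentElem e → e = 0 ∨ e = 1) : IsLocalRing A where
  isUnit_or_isUnit_of_add_one {a b} hab := by
    obtain rfl : b = 1 - a := eq_sub_of_add_eq' hab
    obtain ⟨n, y, hn, hc, hi, hy⟩ := exists_isIdempotentElem_fitting R a
    rcases h _ hi with h | h
    · right
      rw [h, mul_zero] at hy
      exact IsNilpotent.isUnit_one_sub ⟨n, hy.symm⟩
    · left
      have : IsUnit (a ^ n) := by
        have h' := h
        rw [(hc.pow_pow n n).eq] at h'
        exact ⟨⟨_, _, h, h'⟩, rfl⟩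
      exact (isUnit_pow_iff hn.ne').1 this

end Fitting

/-! ### Decomposition into objects with local endomorphism rings -/

section KrullSchmidt

variable {T : Type u} [Category.{v} T] [Preadditive T] [HasFiniteBiproducts T]
  [HasBinaryBiproducts T]

/-- The objects which are finite direct sums of objects with local endomorphism rings. -/
def isSumOfLocal (T : Type u) [Category.{v} T] [Preadditive T] [HasFiniteBiproducts T] :
    ObjectProperty T :=
  fun X => ∃ (J : Type) (_ : Finite J) (Y : J → T),
    Nonempty (X ≅ ⨁ Y) ∧ ∀ j, IsLocalRing (End (Y j))

lemma isSumOfLocal_of_iso_biprod {X Y Z : T} (e : X ≅ Y ⊞ Z) (hY : isSumOfLocal T Y)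
    (hZ : isSumOfLocal T Z) : isSumOfLocal T X := by
  obtain ⟨J, _, F, ⟨a⟩, hF⟩ := hY
  obtain ⟨K, _, G, ⟨b⟩, hG⟩ := hZ
  let l : ∀ s : J ⊕ K, (⨁ F) ⊞ (⨁ G) ⟶ Sum.elim F G s :=
    Sum.rec (fun j => biprod.fst ≫ biproduct.π F j) fun k => biprod.snd ≫ biproduct.π G k
  let p : (⨁ (Sum.elim F G)) ⟶ ⨁ F :=
    biproduct.lift fun j => biproduct.π (Sum.elim F G) (Sum.inl j)
  let q : (⨁ (Sum.elim F G)) ⟶ ⨁ G :=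
    biproduct.lift fun k => biproduct.π (Sum.elim F G) (Sum.inr k)
  have hp (j : J) : p ≫ biproduct.π F j = biproduct.π (Sum.elim F G) (Sum.inl j) :=
    biproduct.lift_π _ _
  have hq (k : K) : q ≫ biproduct.π G k = biproduct.π (Sum.elim F G) (Sum.inr k) :=
    biproduct.lift_π _ _
  have hl (s : J ⊕ K) : biproduct.lift l ≫ biproduct.π (Sum.elim F G) s = l s :=
    biproduct.lift_π _ _
  let c : (⨁ F) ⊞ (⨁ G) ≅ ⨁ (Sum.elim F G) :=
    { hom := biproduct.lift l
      inv := biprod.lift p q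
      hom_inv_id := by
        apply biprod.hom_ext
        · refine biproduct.hom_ext _ _ fun j => ?_
          rw [Category.assoc, Category.assoc, biprod.lift_fst_assoc, hp, Category.id_comp]
          exact hl _
        · refine biproduct.hom_ext _ _ fun k => ?_
          rw [Category.assoc, Category.assoc, biprod.lift_snd_assoc, hq, Category.id_comp]
          exact hl _
      inv_hom_id := by
        refine biproduct.hom_ext _ _ fun s => ?_
        rw [Category.assoc, hl, Category.id_comp]
        cases s with
        | inl j => exact (biprod.lift_fst_assoc _ _ _).trans (hp j)
        | inr k => exact (biprod.lift_snd_assoc _ _ _).trans (hq k) }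
  refine ⟨J ⊕ K, inferInstance, Sum.elim F G, ⟨e ≪≫ biprod.mapIso a b ≪≫ c⟩, ?_⟩
  rintro (j | k)
  · exact hF j
  · exact hG k

variable {R : Type w} [CommRing R] [IsArtinianRing R] [Linear R T]

/-- `End Y` embeds in `End X` by `g ↦ p ≫ g ≫ i`, and the identity is in the image only if `p ≫ i =
𝟙 X`. -/
lemma length_end_lt (hT : IsHomFinite R T) {X Y : T} (i : Y ⟶ X) (p : X ⟶ Y) (h : i ≫ p = 𝟙 Y)
    (hX : p ≫ i ≠ 𝟙 X) : Module.length R (End Y) < Module.length R (End X) := by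
  have : Module.Finite R (End X) := hT X X
  let φ : End Y →ₗ[R] End X := (Linear.leftComp R X p) ∘ₗ (Linear.rightComp R Y i)
  have hφ (g : End Y) : φ g = p ≫ g ≫ i := rfl
  have hinj : Function.Injective φ := fun g g' hg => by
    have : i ≫ (p ≫ g ≫ i) ≫ p = i ≫ (p ≫ g' ≫ i) ≫ p := by
      rw [← hφ, ← hφ, hg]
    simpa [h, reassoc_of% h] using this
  have : IsNoetherian R (End X) := isNoetherian_of_isNoetherianRing_of_finite R _
  have : IsArtinian R (End X) := isArtinian_of_fg_of_artinian' 
  rw [(LinearEquiv.ofInjective φ hinj).length_eq]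
  refine Submodule.length_lt fun htop => hX ?_
  obtain ⟨g, hg⟩ : (𝟙 X : End X) ∈ LinearMap.range φ := htop ▸ Submodule.mem_top
  rw [hφ] at hg
  have h1 : (p ≫ i) ≫ (p ≫ g ≫ i) = p ≫ g ≫ i := by
    simp [reassoc_of% h]
  rw [hg] at h1
  exact (Category.comp_id _).symm.trans h1

/-- Induction on the length of `End X`: a nonlocal endomorphism ring has a nontrivial idempotent,
which splits off two summands with shorter endomorphism rings. -/
theorem isKrullSchmidt_of_isIdempotentComplete (hT : IsHomFinite R T) [IsIdempotentComplete T] :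
    IsKrullSchmidt T where
  hasFiniteBiproducts := inferInstance
  exists_decomposition := by
    have main (X : T) : isSumOfLocal T X := by
      induction h : Module.length R (End X) using WellFoundedLT.induction generalizing X with
      | ind l ih =>
        subst h
        by_cases h0 : IsZero X
        · exact ⟨Empty, inferInstance, Empty.elim, ⟨h0.iso (by
            rw [IsZero.iff_id_eq_zero]
            exact biproduct.hom_ext _ _ fun j => j.elim)⟩, fun j => j.elim⟩
        have : Nontrivial (End X) := by
          refine ⟨𝟙 X, 0, fun h => h0 ((IsZero.iff_id_eq_zero X).2 h)⟩
        by_cases hl : IsLocalRing (End X)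
        · exact ⟨Unit, inferInstance, fun _ => X, ⟨(biproductUniqueIso fun _ : Unit => X).symm⟩, fun _ => hl⟩
        have : Module.Finite R (End X) := hT X X
        have : ∃ e : End X, IsIdempotentElem e ∧ e ≠ 0 ∧ e ≠ 1 := by
          by_contra! hcon
          exact hl (isLocalRing_of_isIdempotentElem R fun e he => by
            by_contra! h'
            exact h'.2 (hcon e he h'.1))
        obtain ⟨e, he, he0, he1⟩ : ∃ e : X ⟶ X, e ≫ e = e ∧ e ≠ 0 ∧ e ≠ 𝟙 X := this
        obtain ⟨Y, i, p, hip, hpi⟩ := IsIdempotentComplete.idempotents_split X e he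
        obtain ⟨Z, j, q, hjq, hqj⟩ := IsIdempotentComplete.idempotents_split X (𝟙 X - e)
          (Idempotents.idem_of_id_sub_idem e he)
        have hiq : i ≫ q = 0 := by
          have : i ≫ q = i ≫ (p ≫ i) ≫ (q ≫ j) ≫ q := by simp [hjq, reassoc_of% hip]
          rw [this, hpi, hqj]
          simp [reassoc_of% he]
        have hjp : j ≫ p = 0 := by
          have : j ≫ p = j ≫ (q ≫ j) ≫ (p ≫ i) ≫ p := by simp [hip, reassoc_of% hjq]
          rw [this, hpi, hqj]
          simp [reassoc_of% he]
        let E : X ≅ Y ⊞ Z :=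
          { hom := biprod.lift p q
            inv := biprod.desc i j
            hom_inv_id := by rw [biprod.lift_desc, hpi, hqj, add_sub_cancel]
            inv_hom_id := by
              apply biprod.hom_ext' <;> apply biprod.hom_ext <;> simp [hip, hjq, hiq, hjp] }
        refine isSumOfLocal_of_iso_biprod E (ih _ ?_ Y rfl) (ih _ ?_ Z rfl)
        · exact length_end_lt hT i p hip (fun h => he1 (hpi.symm.trans h))
        · refine length_end_lt hT j q hjq (fun h => he0 ?_)
          rw [hqj] at h
          exact sub_eq_self.1 h
    intro X
    obtain ⟨J, hJ, Y, ⟨e⟩, hY⟩ := main X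
    obtain ⟨n, ⟨f⟩⟩ := Finite.exists_equiv_fin J
    exact ⟨n, Y ∘ f.symm, (biproduct.bicone Y).whisker f.symm,
      ⟨(Bicone.whiskerIsBilimitIff _ _).symm (biproduct.isBilimit Y)⟩, ⟨e.symm⟩, fun i => hY _⟩

end KrullSchmidt

/-! ### Hom-finiteness and split idempotents in the bounded homotopy category -/

section

variable {R : Type w} [CommRing R] {C : Type u} [Category.{v} C] [Preadditive C] [Linear R C]

/-- The components of a morphism of complexes in a range of degrees. -/
def CochainComplex.componentsLinearMap (R : Type w) [CommRing R] [Linear R C]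
    (K L : CochainComplex C ℤ) (a b : ℤ) :
    (K ⟶ L) →ₗ[R] ∀ i : Set.Icc a b, K.X i ⟶ L.X i where
  toFun f i := f.f i
  map_add' _ _ := rfl
  map_smul' _ _ := rfl

lemma CochainComplex.finite_hom [IsNoetherianRing R] (hC : IsHomFinite R C)
    {K : CochainComplex C ℤ} (hK : ∃ a b : ℤ, ∀ i : ℤ, i < a ∨ b < i → IsZero (K.X i))
    (L : CochainComplex C ℤ) : Module.Finite R (K ⟶ L) := by
  obtain ⟨a, b, h⟩ := hK
  have (i : Set.Icc a b) : Module.Finite R (K.X i ⟶ L.X i) := hC _ _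
  refine Module.Finite.of_injective (componentsLinearMap R K L a b) fun f g hfg => ?_
  ext i
  by_cases hi : i < a ∨ b < i
  · exact (h i hi).eq_of_src _ _
  · exact congrFun hfg ⟨i, by push Not at hi; exact hi⟩

theorem isHomFinite_Kb [IsNoetherianRing R] (hC : IsHomFinite R C) : IsHomFinite R (Kb C) := by
  intro X Y
  obtain ⟨K, hK⟩ := HomotopyCategory.quotient_obj_surjective X.obj
  obtain ⟨L, hL⟩ := HomotopyCategory.quotient_obj_surjective Y.obj
  have := CochainComplex.finite_hom hC X.property Y.obj.as
  have : Module.Finite R (X.obj ⟶ Y.obj) :=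
    Module.Finite.of_surjective
      (((HomotopyCategory.quotient C (.up ℤ)).mapLinearMap R :
        (X.obj.as ⟶ Y.obj.as) →ₗ[R] _))
      (HomotopyCategory.quotient C (.up ℤ)).map_surjective
  exact Module.Finite.equiv (fullSubcategoryHomEquiv R X Y).symm

end

section

lemma CategoryTheory.Retract.isZero {C : Type u} [Category.{v} C] [HasZeroMorphisms C] {X Y : C}
    (h : Retract X Y) (hY : IsZero Y) : IsZero X := by
  rw [IsZero.iff_id_eq_zero, ← h.retract, hY.eq_zero_of_tgt h.i, zero_comp]

variable {C : Type u} [Category.{v} C] [Abelian C]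

/-- Endomorphisms of the complex form a finite `R`-algebra surjecting onto those up to homotopy, so
an idempotent lifts to a strict one, which splits in the abelian category of complexes. -/
theorem isIdempotentComplete_Kb (R : Type w) [CommRing R] [IsArtinianRing R] [Linear R C]
    (hC : IsHomFinite R C) : IsIdempotentComplete (Kb C) where
  idempotents_split X e he := by
    have := CochainComplex.finite_hom hC X.property X.obj.as
    have : Module.Finite R (End X.obj.as) := this
    let φ : End X.obj.as →+* End X :=
      { toFun f := ObjectProperty.homMk ((HomotopyCategory.quotient C (.up ℤ)).map f)
        map_one' := ObjectProperty.hom_ext _ ((HomotopyCategory.quotient C (.up ℤ)).map_id X.obj.as)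
        map_mul' f g := ObjectProperty.hom_ext _ ((HomotopyCategory.quotient C (.up ℤ)).map_comp g f)
        map_zero' := ObjectProperty.hom_ext _ ((HomotopyCategory.quotient C (.up ℤ)).map_zero _ _)
        map_add' f g := ObjectProperty.hom_ext _ ((HomotopyCategory.quotient C (.up ℤ)).map_add) }
    have hφ : Function.Surjective φ := fun f => by
      obtain ⟨f', hf'⟩ := (HomotopyCategory.quotient C (.up ℤ)).map_surjective f.hom
      exact ⟨f', ObjectProperty.hom_ext _ hf'⟩
    obtain ⟨f, hf, rfl⟩ := exists_isIdempotentElem_lift R φ hφ (e := e) he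
    obtain ⟨Y, i, p, hip, hpi⟩ := IsIdempotentComplete.idempotents_split X.obj.as f hf
    have hY : ∃ a b : ℤ, ∀ i : ℤ, i < a ∨ b < i → IsZero (Y.X i) := by
      obtain ⟨a, b, h⟩ := X.property
      refine ⟨a, b, fun n hn => ?_⟩
      have : Retract (Y.X n) (X.obj.as.X n) :=
        { i := i.f n
          r := p.f n
          retract := by rw [← HomologicalComplex.comp_f, hip]; rfl }
      exact this.isZero (h n hn)
    refine ⟨Kb.of Y hY, ObjectProperty.homMk ((HomotopyCategory.quotient C (.up ℤ)).map i),
      ObjectProperty.homMk ((HomotopyCategory.quotient C (.up ℤ)).map p),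
      ObjectProperty.hom_ext _ ?_, ObjectProperty.hom_ext _ ?_⟩
    · refine ((HomotopyCategory.quotient C (.up ℤ)).map_comp i p).symm.trans ?_
      rw [hip]
      exact CategoryTheory.Functor.map_id _ _
    · refine ((HomotopyCategory.quotient C (.up ℤ)).map_comp p i).symm.trans ?_
      rw [hpi]
      rfl

lemma isAcyclicComplex_of_retract {X Y : Kb C} (h : Retract Y X) (hX : isAcyclicComplex C X) :
    isAcyclicComplex C Y := by
  rw [isAcyclicComplex_eq, ObjectProperty.prop_inverseImage_iff,
    HomotopyCategory.mem_subcategoryAcyclic_iff] at hX ⊢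
  exact fun n => (h.map ((isBoundedComplex C).ι ⋙
    HomotopyCategory.homologyFunctor C (.up ℤ) n)).isZero (hX n)

theorem isIdempotentComplete_Kbac [IsIdempotentComplete (Kb C)] :
    IsIdempotentComplete (Kbac C) where
  idempotents_split X e he := by
    obtain ⟨Y, i, p, hip, hpi⟩ := IsIdempotentComplete.idempotents_split X.obj e.hom
      (congrArg (fun f : X ⟶ X => f.hom) he)
    have hY : isAcyclicComplex C Y :=
      isAcyclicComplex_of_retract { i := i, r := p, retract := hip } X.property
    exact ⟨⟨Y, hY⟩, ObjectProperty.homMk i, ObjectProperty.homMk p,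
      ObjectProperty.hom_ext _ hip, ObjectProperty.hom_ext _ hpi⟩

theorem isKrullSchmidt_Kb (R : Type w) [CommRing R] [IsArtinianRing R] [Linear R C]
    (hC : IsHomFinite R C) : IsKrullSchmidt (Kb C) :=
  have := isIdempotentComplete_Kb R hC
  isKrullSchmidt_of_isIdempotentComplete (isHomFinite_Kb hC)

theorem isKrullSchmidt_Kbac (R : Type w) [CommRing R] [IsArtinianRing R] [Linear R C]
    (hC : IsHomFinite R C) : IsKrullSchmidt (Kbac C) :=
  have := isIdempotentComplete_Kb R hC
  have : IsIdempotentComplete (Kbac C) := isIdempotentComplete_Kbac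
  isKrullSchmidt_of_isIdempotentComplete ((isHomFinite_Kb hC).fullSubcategory _)

end

/-! ### Abelian categories with a separator that has a Serre dual -/

section Separator

variable {R : Type w} [CommRing R] {E : Type w} [AddCommGroup E] [Module R E]
  {C : Type u} [Category.{v} C] [Abelian C] [Linear R C]
  {G J : C} {θ : (G ⟶ J) →ₗ[R] E}

/-- A morphism is zero if composition with it kills a spanning family. -/
lemma comp_eq_zero_of_span {X Y Z : C} {n : ℕ} (s : Fin n → (X ⟶ Y))
    (hs : Submodule.span R (Set.range s) = ⊤) (h : Y ⟶ Z) (hh : ∀ i, s i ≫ h = 0) (x : X ⟶ Y) :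
    x ≫ h = 0 := by
  have : Submodule.span R (Set.range s) ≤ LinearMap.ker (Linear.rightComp R X h) := by
    rw [Submodule.span_le]
    rintro _ ⟨i, rfl⟩
    exact hh i
  exact this (hs ▸ Submodule.mem_top)

/-- Finitely many generators of `Hom(G, M)` define an epimorphism `Gⁿ → M`, and `Gⁿ` has the Serre
dual `Jⁿ`. -/
lemma IsSerrePair.exists_epi (hθ : IsSerrePair θ) (hC : IsHomFinite R C) (hG : IsSeparator G)
    (M : C) : ∃ (P : C) (p : P ⟶ M), Epi p ∧ hasSerreDual R E C P := by
  have := hC G M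
  have : HasFiniteBiproducts C := Abelian.hasFiniteBiproducts
  obtain ⟨n, s, hs⟩ := Module.Finite.exists_fin (R := R) (M := (G ⟶ M))
  obtain ⟨θ', hθ'⟩ := hθ.biproduct n
  refine ⟨_, biproduct.desc s, Preadditive.epi_of_cancel_zero _ fun h hh => ?_, _, θ', hθ'⟩
  refine (Preadditive.isSeparator_iff G).1 hG h (comp_eq_zero_of_span s hs h fun i => ?_)
  rw [← biproduct.ι_desc s i, Category.assoc, hh, comp_zero]

/-- `J` is a coseparator: functionals on `Hom(G, N)` are induced by morphisms `N ⟶ J` and separate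
points. -/
lemma IsSerrePair.exists_mono (hE : IsMatlisDualizing.{w, v, w} R E) (hθ : IsSerrePair θ)
    (hC : IsHomFinite R C) (hG : IsSeparator G) (N : C) :
    ∃ (I : C) (i : N ⟶ I), Mono i ∧ isSerreDual R E C I := by
  have := hC N J
  have : HasFiniteBiproducts C := Abelian.hasFiniteBiproducts
  obtain ⟨n, s, hs⟩ := Module.Finite.exists_fin (R := R) (M := (N ⟶ J))
  obtain ⟨θ', hθ'⟩ := hθ.biproduct n
  refine ⟨_, biproduct.lift s, Preadditive.mono_of_cancel_zero _ fun {W} h hh => ?_, _, θ', hθ'⟩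
  have h' (g : N ⟶ J) : h ≫ g = 0 := by
    have : Submodule.span R (Set.range s) ≤ LinearMap.ker (Linear.leftComp R J h) := by
      rw [Submodule.span_le]
      rintro _ ⟨i, rfl⟩
      change h ≫ s i = 0
      rw [← biproduct.lift_π s i, ← Category.assoc, hh, zero_comp]
    exact this (hs ▸ Submodule.mem_top)
  refine (Preadditive.isSeparator_iff G).1 hG h fun x => ?_
  apply (hE.bijective_dualEval (G ⟶ N) (hC G N)).1
  ext φ
  obtain ⟨g, hg⟩ := hθ.surjective φ
  rw [map_zero, LinearMap.zero_apply]
  change φ (x ≫ h) = 0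
  rw [← hg, Category.assoc, h', comp_zero, map_zero]

end Separator

/-! ### Injective dimension from projective dimension -/

section Dimension

variable {C : Type u} [Category.{v} C] [Abelian C]

/-- Both dimensions are governed by the vanishing of the same `Ext` groups. -/
lemma hasInjectiveDimensionLT_of_forall {n : ℕ} (h : ∀ M : C, HasProjectiveDimensionLT M n)
    (N : C) : HasInjectiveDimensionLT N n := by
  let := HasExt.standard C
  rw [hasInjectiveDimensionLT_iff]
  intro i hi M e
  have := h M
  exact e.eq_zero_of_hasProjectiveDimensionLT n hi

end Dimension

/-! ### Finitely generated modules -/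

namespace FGModuleCat

variable {A : Type v} [Ring A] [IsNoetherianRing A]

lemma exists_shortExact (M : FGModuleCat.{v} A) :
    ∃ S : ShortComplex (FGModuleCat.{v} A), S.ShortExact ∧ S.X₃ = M ∧
      Module.Projective A S.X₂ := by
  obtain ⟨n, f, hf⟩ := Module.Finite.exists_fin' A M
  let p : FGModuleCat.of A (Fin n → A) ⟶ M := ObjectProperty.homMk (ModuleCat.ofHom f)
  have : Epi p := (forget₂ (FGModuleCat A) (ModuleCat.{v} A)).epi_of_epi_map
    ((ModuleCat.epi_iff_surjective _).2 hf)
  exact ⟨ShortComplex.mk (kernel.ι p) p (kernel.condition p),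
    { exact := ShortComplex.exact_kernel p }, rfl,
    inferInstanceAs (Module.Projective A (Fin n → A))⟩

/-- The forgetful functor is exact and reflects projectivity, so dimensions can be compared by
passing to syzygies. -/
lemma hasProjectiveDimensionLT_of_forget₂ (n : ℕ) (M : FGModuleCat.{v} A)
    (h : HasProjectiveDimensionLT M.obj n) : HasProjectiveDimensionLT M n := by
  let F := forget₂ (FGModuleCat A) (ModuleCat.{v} A)
  have h1 (M : FGModuleCat.{v} A) (h : Projective (F.obj M)) : Projective M :=
    F.projective_of_map_projective h
  induction n using Nat.twoStepInduction generalizing M with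
  | zero =>
    rw [hasProjectiveDimensionLT_zero_iff_isZero] at h ⊢
    rw [IsZero.iff_id_eq_zero] at h ⊢
    exact F.map_injective h
  | one =>
    rw [← projective_iff_hasProjectiveDimensionLT_one] at h ⊢
    exact h1 M h
  | more n _ ih =>
    obtain ⟨S, hS, rfl, hP⟩ := exists_shortExact M
    have hP' : Projective (F.obj S.X₂) := (IsProjective.iff_projective _).1 hP
    rw [hS.hasProjectiveDimensionLT_X₃_iff n (h1 _ hP')]
    exact ih _ (((hS.map_of_exact F).hasProjectiveDimensionLT_X₃_iff n hP').1 h)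

end FGModuleCat

/-! ### The category of finitely generated right modules over an artin algebra -/

namespace FGRightMod

variable (R : Type u) [CommRing R] (Λ : Type v) [Ring Λ] [Algebra R Λ]

/-- The regular right module. -/
abbrev regular : FGRightMod Λ := FGModuleCat.of Λᵐᵒᵖ Λᵐᵒᵖ

variable {Λ} in
/-- The homomorphism from the regular module which sends `1` to `y`. -/
noncomputable def homOf (Y : FGRightMod Λ) : Y →+ (regular Λ ⟶ Y) where
  toFun y := ObjectProperty.homMk (ModuleCat.ofHom (LinearMap.toSpanSingleton Λᵐᵒᵖ Y y))
  map_zero' := FGModuleCat.hom_ext (by ext; exact smul_zero _)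
  map_add' y z := FGModuleCat.hom_ext (by ext; exact smul_add _ y z)

variable {Λ} in
/-- The value at `1` of a homomorphism from the regular module. -/
def evalOne {Y : FGRightMod Λ} (f : regular Λ ⟶ Y) : Y := f.hom.hom (1 : Λᵐᵒᵖ)

variable {Λ}

lemma homOf_evalOne {Y : FGRightMod Λ} (f : regular Λ ⟶ Y) : homOf Y (evalOne f) = f :=
  FGModuleCat.hom_ext (by ext; exact one_smul _ _)

lemma evalOne_homOf {Y : FGRightMod Λ} (y : Y) : evalOne (homOf Y y) = y := one_smul Λᵐᵒᵖ y

lemma homOf_smul {Y : FGRightMod Λ} (r : R) (y : Y) :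
    homOf Y (algebraMap R Λᵐᵒᵖ r • y) = r • homOf Y y :=
  FGModuleCat.hom_ext (by
    ext
    exact (one_smul Λᵐᵒᵖ _).trans
      (congrArg (algebraMap R Λᵐᵒᵖ r • ·) (one_smul Λᵐᵒᵖ y).symm))

lemma isSeparator_regular : IsSeparator (regular Λ) := by
  rw [Preadditive.isSeparator_iff]
  intro X Y f hf
  apply FGModuleCat.hom_ext
  ext x
  have := congrArg evalOne (hf (homOf X x))
  exact (congrArg f.hom.hom (evalOne_homOf x)).symm.trans this

lemma isHomFinite [IsNoetherianRing R] [Module.Finite R Λ] : IsHomFinite R (FGRightMod Λ) := by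
  intro X Y
  let _ : Module R X := Module.restrictScalars R Λᵐᵒᵖ X
  have : IsScalarTower R Λᵐᵒᵖ X := IsScalarTower.restrictScalars R Λᵐᵒᵖ X
  let _ : Module R Y := Module.restrictScalars R Λᵐᵒᵖ Y
  have : IsScalarTower R Λᵐᵒᵖ Y := IsScalarTower.restrictScalars R Λᵐᵒᵖ Y
  have : Module.Finite R X := Module.Finite.trans Λᵐᵒᵖ X
  have : Module.Finite R Y := Module.Finite.trans Λᵐᵒᵖ Y
  let φ : (X ⟶ Y) →ₗ[R] (X →ₗ[R] Y) :=
    { toFun f := f.hom.hom.restrictScalars R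
      map_add' _ _ := rfl
      map_smul' _ _ := rfl }
  exact Module.Finite.of_injective φ fun f g h =>
    FGModuleCat.hom_ext (LinearMap.restrictScalars_injective R h)

variable (Λ) (E : Type w) [AddCommGroup E] [Module R E]

/-- `Hom_R(Λ, E)` as a right `Λ`-module. -/
abbrev dualModule : Module Λᵐᵒᵖ (Λ →ₗ[R] E) where
  smul a φ := φ ∘ₗ LinearMap.mulLeft R a.unop
  one_smul _ := by ext; exact congrArg _ (one_mul _)
  mul_smul _ _ _ := by ext; exact congrArg _ (mul_assoc _ _ _)
  smul_zero _ := rfl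
  smul_add _ _ _ := rfl
  add_smul _ _ φ := by ext; exact (congrArg φ (add_mul _ _ _)).trans (map_add _ _ _)
  zero_smul φ := by ext; exact (congrArg φ (zero_mul _)).trans (map_zero _)

/-- `Λ →ₗ[R] E` may live in a larger universe than `mod Λ`; as a finitely generated `Λᵐᵒᵖ`-module it
is small and can be replaced by a copy. -/
lemma exists_linearEquiv_dualModule [hf : Module.Finite R (Λ →ₗ[R] E)] :
    letI := dualModule R Λ E
    ∃ J : FGRightMod Λ, Nonempty (J ≃ₗ[Λᵐᵒᵖ] (Λ →ₗ[R] E)) := by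
  let _ := dualModule R Λ E
  have : IsScalarTower R Λᵐᵒᵖ (Λ →ₗ[R] E) := ⟨fun r a φ => by
    ext x
    exact (congrArg φ (smul_mul_assoc r a.unop x)).trans (map_smul φ _ _)⟩
  have := Module.Finite.of_restrictScalars_finite R Λᵐᵒᵖ (Λ →ₗ[R] E)
  obtain ⟨n, f, hf⟩ := Module.Finite.exists_fin' Λᵐᵒᵖ (Λ →ₗ[R] E)
  have : Small.{v} (Λ →ₗ[R] E) := small_of_surjective hf
  have := Module.Finite.equiv (Shrink.linearEquiv.{v} Λᵐᵒᵖ (Λ →ₗ[R] E)).symm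
  exact ⟨FGModuleCat.of Λᵐᵒᵖ (Shrink.{v} (Λ →ₗ[R] E)), ⟨Shrink.linearEquiv.{v} Λᵐᵒᵖ (Λ →ₗ[R] E)⟩⟩

/-- Hom-tensor adjunction: `Hom(Y, D Λ) ≅ D Y ≅ D Hom(Λ, Y)`. The functional evaluates a morphism `Λ
→ D Λ` at `1`, and the result at `1` again. -/
theorem exists_isSerrePair_regular (E : Type u) [AddCommGroup E] [Module R E]
    [Module.Finite R (Λ →ₗ[R] E)] :
    ∃ (J : FGRightMod Λ) (θ : (regular Λ ⟶ J) →ₗ[R] E), IsSerrePair θ := by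
  let _ := dualModule R Λ E
  obtain ⟨J, ⟨e⟩⟩ := exists_linearEquiv_dualModule R Λ E
  let θ : (regular Λ ⟶ J) →ₗ[R] E :=
    { toFun f := e (evalOne f) 1
      map_add' f g := by
        change e (evalOne f + evalOne g) 1 = _
        rw [map_add, LinearMap.add_apply]
      map_smul' r f := by
        change e (algebraMap R Λᵐᵒᵖ r • evalOne f) 1 = _
        rw [map_smul]
        change e (evalOne f) (algebraMap R Λ r * 1) = _
        rw [← Algebra.smul_def, map_smul, RingHom.id_apply] }
  have key {Y : FGRightMod Λ} (g : Y ⟶ J) (y : Y) (a : Λ) :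
      e (g.hom.hom y) a = θ (homOf Y (MulOpposite.op a • y) ≫ g) := by
    change _ = e (g.hom.hom (evalOne (homOf Y (MulOpposite.op a • y)))) 1
    rw [evalOne_homOf, map_smul, map_smul]
    exact congrArg (e (g.hom.hom y)) (mul_one a).symm
  refine ⟨J, θ, fun Y => ⟨fun g g' hg => FGModuleCat.hom_ext (LinearMap.ext fun y =>
    e.injective (LinearMap.ext fun a => ?_)), fun ψ => ?_⟩⟩
  · rw [key, key]
    exact LinearMap.congr_fun hg _
  -- Under `Y ≅ Hom(Λ, Y)`, `ψ` is a functional on `Y`, and `γ` sends `y` to `a ↦ ψ (y a)`.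
  · let γ : Y →ₗ[Λᵐᵒᵖ] (Λ →ₗ[R] E) :=
      { toFun y :=
          { toFun a := ψ (homOf Y (MulOpposite.op a • y))
            map_add' a b := by rw [MulOpposite.op_add, add_smul, map_add, map_add]
            map_smul' r a := by
              rw [RingHom.id_apply, ← map_smul, ← homOf_smul, smul_smul, Algebra.smul_def,
                Algebra.commutes]
              rfl }
        map_add' y z := by
          ext a
          change ψ (homOf Y (MulOpposite.op a • (y + z))) = _
          rw [smul_add, map_add, map_add]
          rfl
        map_smul' b y := by
          ext a
          change ψ (homOf Y (MulOpposite.op a • b • y)) =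
            ψ (homOf Y (MulOpposite.op (b.unop * a) • y))
          rw [smul_smul]
          rfl }
    let g : Y ⟶ J := ObjectProperty.homMk (ModuleCat.ofHom (e.symm.toLinearMap ∘ₗ γ))
    refine ⟨g, LinearMap.ext fun f => ?_⟩
    have h : e (g.hom.hom (evalOne f)) = γ (evalOne f) := e.apply_symm_apply _
    change e (g.hom.hom (evalOne f)) 1 = ψ f
    rw [h]
    change ψ (homOf Y ((1 : Λᵐᵒᵖ) • evalOne f)) = ψ f
    rw [one_smul, homOf_evalOne]

end FGRightMod

theorem mainTheorem3
    (R : Type u) [CommRing R] [IsArtinianRing R]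
    (Λ : Type v) [Ring Λ] [Algebra R Λ] [Module.Finite R Λ]
    (hΛ : HasFiniteGlobalDimension Λᵐᵒᵖ)
    (E : Type u) [AddCommGroup E] [Module R E]
    (ι : (R ⧸ Ring.jacobson R) →ₗ[R] E) (hE : IsInjectiveEnvelope ι) :
    -- the categories for which Serre functors are considered
    (IsHomFinite R (Kb (FGRightMod Λ)) ∧ IsKrullSchmidt (Kb (FGRightMod Λ))) ∧
    (IsHomFinite R (Kbac (FGRightMod Λ)) ∧ IsKrullSchmidt (Kbac (FGRightMod Λ))) ∧
    -- the functors `U` and `i_ρ` exist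
    (∃ U : Kb (FGRightMod Λ) ⥤ Kb (FGRightMod Λ), IsSerreFunctor R E U) ∧
    (Kbac.inclusion (FGRightMod Λ)).IsLeftAdjoint ∧
    -- and `i_ρ ∘ U ∘ i` is a Serre functor
    (∀ (U : Kb (FGRightMod Λ) ⥤ Kb (FGRightMod Λ))
      (iρ : Kb (FGRightMod Λ) ⥤ Kbac (FGRightMod Λ)),
      IsSerreFunctor R E U → Nonempty (Kbac.inclusion (FGRightMod Λ) ⊣ iρ) →
        IsSerreFunctor R E (Kbac.inclusion (FGRightMod Λ) ⋙ U ⋙ iρ)) := by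
  have : IsNoetherianRing Λᵐᵒᵖ := IsNoetherianRing.of_finite R Λᵐᵒᵖ
  have hC : IsHomFinite R (FGRightMod Λ) := FGRightMod.isHomFinite R
  have hK := isHomFinite_Kb hC
  have hE' : IsMatlisDualizing.{u, v, u} R E := hE.isMatlisDualizing
  have := hE.finite_dual Λ
  obtain ⟨J, θ, hθ⟩ := FGRightMod.exists_isSerrePair_regular R Λ E
  have hP := hθ.exists_epi hC FGRightMod.isSeparator_regular
  have hI := hθ.exists_mono hE' hC FGRightMod.isSeparator_regular
  have : EnoughProjectives (FGRightMod Λ) := ⟨fun M => by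
    obtain ⟨P, p, hp, h⟩ := hP M
    have := projective_of_hasSerreDual hE' hC h
    exact ⟨{ p := P, f := p }⟩⟩
  have : EnoughInjectives (FGRightMod Λ) := ⟨fun M => by
    obtain ⟨I, i, hi, h⟩ := hI M
    have := injective_of_isSerreDual hE.baer h
    exact ⟨{ J := I, f := i }⟩⟩
  obtain ⟨n, hn⟩ := hΛ
  have hpd (M : FGRightMod Λ) : HasProjectiveDimensionLT M (n + 1) :=
    FGModuleCat.hasProjectiveDimensionLT_of_forget₂ _ _ (hn _)
  have hr := Kb.hasSerreDual_of_epi hE.baer hP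
  have hl := Kb.isSerreDual_of_mono hE' hC hK hI
  refine ⟨⟨hK, isKrullSchmidt_Kb R hC⟩, ⟨hK.fullSubcategory _, isKrullSchmidt_Kbac R hC⟩,
    exists_isSerreFunctor hE' hK hr hl,
    isLeftAdjoint_ι_of_exists_coreflection _ (Kb.exists_coreflection_acyclic _
      fun M => ⟨_, hasInjectiveDimensionLT_of_forall hpd M⟩), ?_⟩
  rintro U iρ hU ⟨adj⟩
  -- The reflections onto acyclic complexes come from finite projective resolutions.
  exact isSerreFunctor_of_coreflective hE' hK _ hU hl adj
    (Kb.exists_reflection_acyclic _ fun M => ⟨_, hpd M⟩)
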